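/- All notions are local at the origin of $\mathbb{R}^n$; vector fields, functions and coordinate changes are smooth near $0$, and coordinate changes fix $0$. **Multi-indices.** A multi-index is $\alpha=(\alpha_1,\dots,\alpha_n)\in\mathbb{Z}_{\ge 0}^n$ (shorter ones are padded by zeros); it is a proper $k$-multi-index if $\alpha_k\ge 1$ and $\alpha_{k+1}=\dots=\alpha_n=0$. Let $\mathcal{A}_k$ be the set of all proper $k$-multi-indices. A local coordinate change $y=U(x)$ is lower triangular if $y_i=U_i(x_1,\dots,x_i)$ for all $i$. We say that $\alpha$ generates $\beta$, written $\alpha\preceq\beta$, if there is a lower triangular coordinate change $y=U(x)$ with $x^\alpha=c\,y^\beta+h(y)$ near $0$, where $c\ne0$ and $h$ is a smooth function with $\frac{\partial^\beta h}{\partial y^\beta}(0)=0$; write $\alpha\prec\beta$ if moreover $\alpha\neq\beta$. For a set $E$ of multi-indices, $\mathcal{G}_k(E)$ is the set of proper $k$-multi-indices generated by elements of $E$. For a smooth function $p$ let $\mathcal{I}(p)=\{\alpha:\frac{\partial^\alpha p}{\partial x^\alpha}(0)\neq 0\}$, and let $\mathcal{E}_k(p)$ be the set of proper $k$-multi-indices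 $\alpha\in\mathcal{I}(p)$ such that $\alpha'\prec\alpha$ for no $\alpha'\in\mathcal{I}(p)$. **Systems.** A lower triangular form is a system $\dot x_i=f_i(x_1,\dots,x_{i+1})$ $(1\le i\le n-1)$, $\dot x_n=f_n(x)+g_n(x)v$ with $f_i,g_n$ smooth, $g_n(0)\ne0$, and, for $1\le i\le n-1$, $\partial f_i/\partial x_{i+1}$ not vanishing identically on any nonempty open subset of some neighborhood of $0$. Given sets $E^i$ $(1\le i\le n-1)$ of proper $(i+1)$-multi-indices such that no element of $E^i$ generates another element of $E^i$, the form is of type $[\![E^1,\dots,E^{n-1}]\!]$ if $\mathcal{E}_{i+1}(f_i)=E^i$ for all $i$. Consider $$\dot\xi=F(\xi)+G(\xi)u,\qquad \xi\in\mathbb{R}^n,\ u\in\mathbb{R},$$ with $F,G$ smooth near $0$, $F(0)=0$, $G(0)\ne0$. Local feedback equivalence means transformation by a feedback $u=\alpha_u(\xi)+\beta_u(\xi)v$, with $\alpha_u,\beta_u$ smooth and $\beta_u(0)\neq0$, together with a local coordinate change $x=T(\xi)$, $T(0)=0$. **Distributions.** Say that $D^1,\dots,D^{n+1}$ is a system flag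 of $(F,G)$ if each $D^l$ is a smooth involutive distribution near $0$ of dimension $n-l+1$, $D^{n+1}=\{0\}$, $D^n=\hat D^n=\mathrm{span}\{G\}$, and, successively for $i=n-1,\dots,1$, there is a smooth vector field $G^{i+1}$ lying in $D^{i+1}$ near $0$, and not in $D^{i+2}$ identically near $0$, such that with $\hat D^i=\mathrm{span}\{\mathrm{ad}_{G^{i+1}}F,\hat D^{i+1}\}$ (pointwise spans) one has $D^i=\hat D^i$ on an open set whose closure is a neighborhood of $0$. Here $\mathrm{ad}_XZ=[X,Z]$. For $Y=(Y^1,\dots,Y^n)$ put $\mathrm{ad}_Y^\alpha Z=\mathrm{ad}_{Y^1}^{\alpha_1}\cdots\mathrm{ad}_{Y^n}^{\alpha_n}Z$ (the rightmost factor acts first). Call $(D,X,Y)$ admissible if $D$ is a system flag, $X^1,\dots,X^n$ are smooth vector fields with $X^l\in D^l$ near $0$ and $X^l(0)\notin D^{l+1}(0)$, and $Y^1,\dots,Y^n$ are smooth vector fields such that near $0$ $$D^k=\mathrm{span}\{Y^k,\dots,Y^n\}\ (1\le k\le n),\qquad [X^l,Y^k]\in D^l\ \text{ for all } l>k .$$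 **Corollary.** The system $(F,G)$ is locally feedback equivalent to a lower triangular form of type $[\![E^1,\dots,E^{n-1}]\!]$ if and only if (i) it is locally feedback equivalent to some lower triangular form; and (ii) for every admissible $(D,X,Y)$ and every $i=1,\dots,n-1$, $$\mathrm{ad}_Y^{\epsilon}F(0)\notin D^{i+1}(0)\ \text{ for all }\epsilon\in E^i,\qquad \mathrm{ad}_Y^{\zeta}F(0)\in D^{i+1}(0)\ \text{ for all }\zeta\in\mathcal{A}_{i+1}\setminus\mathcal{G}_{i+1}(E^i).$$ The same equivalence holds if "for every admissible $(D,X,Y)$" in (ii) is replaced by "for some admissible $(D,X,Y)$". -/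

import Mathlib

open Filter
open scoped Topology ContDiff

noncomputable section

namespace TriForm

/-! Conventions. Everything is local at the origin of `ℝⁿ = (Fin n → ℝ)`. Indices are shifted down
by one: the coordinates are `x 0, …, x (n-1)`, so that `x i` is the `(i+1)`-st coordinate. -/

/-- Smooth in some neighborhood of the origin. -/
def SmoothNear {n : ℕ} {E : Type*} [NormedAddCommGroup E] [NormedSpace ℝ E]
    (h : (Fin n → ℝ) → E) : Prop :=
  ∀ᶠ x in 𝓝 (0 : Fin n → ℝ), ContDiffAt ℝ ∞ h x

/-- Near the origin, `h` depends on the first `k` coordinates only. -/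
def DependsOnFirst {n : ℕ} (k : ℕ) (h : (Fin n → ℝ) → ℝ) : Prop :=
  ∃ U ∈ 𝓝 (0 : Fin n → ℝ), ∀ x ∈ U, ∀ y ∈ U,
    (∀ j : Fin n, j.val < k → x j = y j) → h x = h y

/-- A local change of coordinates `y = T x` (a germ of a diffeomorphism fixing the origin). -/
def IsCoordChange {n : ℕ} (T : (Fin n → ℝ) → (Fin n → ℝ)) : Prop :=
  SmoothNear T ∧ T 0 = 0 ∧
    ∃ S : (Fin n → ℝ) → (Fin n → ℝ), SmoothNear S ∧ S 0 = 0 ∧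
      (∀ᶠ x in 𝓝 (0 : Fin n → ℝ), S (T x) = x) ∧
      (∀ᶠ y in 𝓝 (0 : Fin n → ℝ), T (S y) = y)

/-- A local lower triangular change of coordinates: `y_i` is a function of `x_1, …, x_i`. -/
def IsLowerTriangularCoordChange {n : ℕ} (U : (Fin n → ℝ) → (Fin n → ℝ)) : Prop :=
  IsCoordChange U ∧ ∀ i : Fin n, DependsOnFirst (i.val + 1) (fun x => U x i)

/-! ### Multi-indices -/

/-- The monomial `x ^ α`. -/
def monomial {n : ℕ} (α : Fin n → ℕ) (x : Fin n → ℝ) : ℝ := ∏ k, x k ^ α k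

/-- The partial derivative `∂p/∂x_k`. -/
def partialD {n : ℕ} (k : Fin n) (p : (Fin n → ℝ) → ℝ) : (Fin n → ℝ) → ℝ :=
  fun x => fderiv ℝ p x (Pi.single k 1)

/-- The iterated partial derivative `∂^α p / ∂x^α`. -/
def multiD {n : ℕ} (α : Fin n → ℕ) (p : (Fin n → ℝ) → ℝ) : (Fin n → ℝ) → ℝ :=
  (List.finRange n).foldr (fun k q => (partialD k)^[α k] q) p

/-- The last nonzero entry of `α` is the entry `j`, i.e. `α` is a proper `(j+1)`-multi-index. -/
def IsProperAt {n : ℕ} (j : Fin n) (α : Fin n → ℕ) : Prop :=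
  1 ≤ α j ∧ ∀ k : Fin n, j < k → α k = 0

/-- The set of multi-indices of `p`. -/
def indices {n : ℕ} (p : (Fin n → ℝ) → ℝ) : Set (Fin n → ℕ) :=
  {α | multiD α p 0 ≠ 0}

/-- `α` generates `β`: in suitable lower triangular coordinates `y = U x` one has
`x ^ α = c * y ^ β + h y` with `c ≠ 0` and `∂^β h / ∂y^β (0) = 0`. -/
def Generates {n : ℕ} (α β : Fin n → ℕ) : Prop :=
  ∃ U : (Fin n → ℝ) → (Fin n → ℝ), IsLowerTriangularCoordChange U ∧
    ∃ (c : ℝ) (h : (Fin n → ℝ) → ℝ), c ≠ 0 ∧ SmoothNear h ∧ multiD β h 0 = 0 ∧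
      ∀ᶠ x in 𝓝 (0 : Fin n → ℝ), monomial α x = c * monomial β (U x) + h (U x)

/-- `α` generates `β` and differs from it. -/
def StrictlyGenerates {n : ℕ} (α β : Fin n → ℕ) : Prop :=
  Generates α β ∧ α ≠ β

/-- The set of all essential `(j+1)`-multi-indices of `p`. -/
def essentialSet {n : ℕ} (j : Fin n) (p : (Fin n → ℝ) → ℝ) : Set (Fin n → ℕ) :=
  {α | IsProperAt j α ∧ α ∈ indices p ∧ ∀ α' ∈ indices p, ¬ StrictlyGenerates α' α}

/-- `E i`, for every `i` that is not the last index, is a set of proper multi-indices ending at the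
entry `i + 1`, none of which generates another one. (The values of `E` at the last index are not
used.) -/
def IsTypeData {n : ℕ} (E : Fin n → Set (Fin n → ℕ)) : Prop :=
  ∀ i j : Fin n, i.val + 1 = j.val →
    (∀ ε ∈ E i, IsProperAt j ε) ∧ (∀ ε ∈ E i, ∀ ε' ∈ E i, ¬ StrictlyGenerates ε ε')

/-! ### Systems, lower triangular forms, and feedback equivalence -/

/-- `ẋ = f x + g x * v` is a lower triangular form. The condition on `∂f_i/∂x_{i+1}` says that it
vanishes identically on no nonempty open subset of some neighborhood of the origin. -/
structure IsLowerTriangularForm {n : ℕ} (f g : (Fin n → ℝ) → (Fin n → ℝ)) : Prop where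
  smooth_f : SmoothNear f
  smooth_g : SmoothNear g
  dep : ∀ i : Fin n, DependsOnFirst (i.val + 2) (fun x => f x i)
  nonvanishing : ∀ i j : Fin n, i.val + 1 = j.val →
    closure {x | partialD j (fun y => f y i) x ≠ 0} ∈ 𝓝 (0 : Fin n → ℝ)
  g_zero : ∀ i : Fin n, i.val + 1 < n → ∀ᶠ x in 𝓝 (0 : Fin n → ℝ), g x i = 0
  g_ne : ∀ i : Fin n, i.val + 1 = n → g 0 i ≠ 0

/-- The lower triangular form with drift `f` is of type `[[E 0, …, E (n-2)]]`. -/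
def HasType {n : ℕ} (f : (Fin n → ℝ) → (Fin n → ℝ)) (E : Fin n → Set (Fin n → ℕ)) : Prop :=
  ∀ i j : Fin n, i.val + 1 = j.val → essentialSet j (fun x => f x i) = E i

/-- A feedback `u = a ξ + b ξ * v` with `b 0 ≠ 0` and a change of coordinates `x = T ξ` transform
`ξ' = F ξ + G ξ * u` locally into `x' = f x + g x * v`. -/
def FeedbackEquivalent {n : ℕ} (F G f g : (Fin n → ℝ) → (Fin n → ℝ)) : Prop :=
  ∃ (a b : (Fin n → ℝ) → ℝ) (T : (Fin n → ℝ) → (Fin n → ℝ)),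
    SmoothNear a ∧ SmoothNear b ∧ b 0 ≠ 0 ∧ IsCoordChange T ∧
      ∀ᶠ ξ in 𝓝 (0 : Fin n → ℝ), ∀ v : ℝ,
        fderiv ℝ T ξ (F ξ + (a ξ + b ξ * v) • G ξ) = f (T ξ) + v • g (T ξ)

/-- The system `(F, G)` is locally feedback equivalent to some lower triangular form. -/
def EquivToLowerTriangular {n : ℕ} (F G : (Fin n → ℝ) → (Fin n → ℝ)) : Prop :=
  ∃ f g : (Fin n → ℝ) → (Fin n → ℝ), IsLowerTriangularForm f g ∧ FeedbackEquivalent F G f g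

/-- The system `(F, G)` is locally feedback equivalent to some lower triangular form of type `E`. -/
def EquivToType {n : ℕ} (F G : (Fin n → ℝ) → (Fin n → ℝ))
    (E : Fin n → Set (Fin n → ℕ)) : Prop :=
  ∃ f g : (Fin n → ℝ) → (Fin n → ℝ),
    IsLowerTriangularForm f g ∧ HasType f E ∧ FeedbackEquivalent F G f g

/-! ### Distributions and Lie brackets -/

/-- The vector field `V` takes its values in `D` near the origin. -/
def IsSection {n : ℕ} (V : (Fin n → ℝ) → (Fin n → ℝ))
    (D : (Fin n → ℝ) → Submodule ℝ (Fin n → ℝ)) : Prop :=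
  ∀ᶠ x in 𝓝 (0 : Fin n → ℝ), V x ∈ D x

/-- `D` is a smooth involutive distribution of dimension `d` near the origin. -/
structure IsInvolutiveDistribution {n : ℕ} (d : ℕ)
    (D : (Fin n → ℝ) → Submodule ℝ (Fin n → ℝ)) : Prop where
  frame : ∃ v : Fin d → (Fin n → ℝ) → (Fin n → ℝ), (∀ i, SmoothNear (v i)) ∧
    ∀ᶠ x in 𝓝 (0 : Fin n → ℝ), LinearIndependent ℝ (fun i => v i x) ∧
      D x = Submodule.span ℝ (Set.range fun i => v i x)
  involutive : ∀ V W : (Fin n → ℝ) → (Fin n → ℝ), SmoothNear V → SmoothNear W →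
    IsSection V D → IsSection W D → IsSection (VectorField.lieBracket ℝ V W) D

/-- `D 0 ⊇ D 1 ⊇ … ⊇ D n` are the distributions attached to `(F, G)`; here `D l` is what is
usually written `D^{l+1}` and has dimension `n - l`. One has `D n = 0`, `D (n-1) = span {G}`, and,
going down, a vector field `Γ (i+1)` in `D (i+1)` and not in `D (i+2)` is chosen and `D i` is an
involutive distribution that agrees with
`span {[Γ (i+1), F], [Γ (i+2), F], …, [Γ (n-1), F], G}`
on an open set whose closure is a neighborhood of the origin. -/
structure IsSystemFlag {n : ℕ} (F G : (Fin n → ℝ) → (Fin n → ℝ))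
    (D : ℕ → (Fin n → ℝ) → Submodule ℝ (Fin n → ℝ)) : Prop where
  involutive : ∀ l : ℕ, l ≤ n → IsInvolutiveDistribution (n - l) (D l)
  bot : ∀ᶠ x in 𝓝 (0 : Fin n → ℝ), D n x = ⊥
  top : ∀ l : ℕ, l + 1 = n →
    ∀ᶠ x in 𝓝 (0 : Fin n → ℝ), D l x = Submodule.span ℝ {G x}
  step : ∃ Γ : Fin n → (Fin n → ℝ) → (Fin n → ℝ),
    (∀ j : Fin n, 0 < j.val →
      SmoothNear (Γ j) ∧ IsSection (Γ j) (D j.val) ∧ ¬ IsSection (Γ j) (D (j.val + 1))) ∧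
    ∀ i : ℕ, i + 1 < n → ∃ O : Set (Fin n → ℝ), IsOpen O ∧
      closure O ∈ 𝓝 (0 : Fin n → ℝ) ∧
      ∀ x ∈ O, D i x = Submodule.span ℝ
        ({G x} ∪ {w | ∃ j : Fin n, i < j.val ∧ w = VectorField.lieBracket ℝ (Γ j) F x})

/-- Smooth vector fields `X l` in `D l` with `X l 0 ∉ D (l+1) 0`. -/
def IsAdapted {n : ℕ} (D : ℕ → (Fin n → ℝ) → Submodule ℝ (Fin n → ℝ))
    (X : Fin n → (Fin n → ℝ) → (Fin n → ℝ)) : Prop :=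
  ∀ l : Fin n, SmoothNear (X l) ∧ IsSection (X l) (D l.val) ∧ X l 0 ∉ D (l.val + 1) 0

/-- Smooth vector fields `Y 0, …, Y (n-1)` with `D k = span {Y k, …, Y (n-1)}` and
`[X l, Y k] ∈ D l` for `l > k`. -/
structure IsReducedTuple {n : ℕ} (D : ℕ → (Fin n → ℝ) → Submodule ℝ (Fin n → ℝ))
    (X Y : Fin n → (Fin n → ℝ) → (Fin n → ℝ)) : Prop where
  smooth : ∀ k : Fin n, SmoothNear (Y k)
  span_eq : ∀ k : Fin n, ∀ᶠ x in 𝓝 (0 : Fin n → ℝ),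
    D k.val x = Submodule.span ℝ {w | ∃ j : Fin n, k ≤ j ∧ w = Y j x}
  bracket : ∀ k l : Fin n, k < l → IsSection (VectorField.lieBracket ℝ (X l) (Y k)) (D l.val)

/-- `ad_Y^α Z = ad_{Y 0}^{α 0} ad_{Y 1}^{α 1} ⋯ ad_{Y (n-1)}^{α (n-1)} Z`; the rightmost factor acts
first. -/
def adMulti {n : ℕ} (Y : Fin n → (Fin n → ℝ) → (Fin n → ℝ)) (α : Fin n → ℕ)
    (Z : (Fin n → ℝ) → (Fin n → ℝ)) : (Fin n → ℝ) → (Fin n → ℝ) :=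
  (List.finRange n).foldr (fun k W => (VectorField.lieBracket ℝ (Y k))^[α k] W) Z

/-- For every `i` that is not the last index: `ad_Y^ε F (0) ∉ D (i+1) (0)` for all `ε ∈ E i`, and
`ad_Y^ζ F (0) ∈ D (i+1) (0)` for every proper multi-index `ζ` ending at the entry `i + 1` that is
not generated by an element of `E i`. -/
def BracketCondition {n : ℕ} (F : (Fin n → ℝ) → (Fin n → ℝ))
    (D : ℕ → (Fin n → ℝ) → Submodule ℝ (Fin n → ℝ))
    (Y : Fin n → (Fin n → ℝ) → (Fin n → ℝ)) (E : Fin n → Set (Fin n → ℕ)) : Prop :=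
  ∀ i j : Fin n, i.val + 1 = j.val →
    (∀ ε ∈ E i, adMulti Y ε F 0 ∉ D (i.val + 1) 0) ∧
    (∀ ζ : Fin n → ℕ, IsProperAt j ζ → (∀ ε ∈ E i, ¬ Generates ε ζ) →
      adMulti Y ζ F 0 ∈ D (i.val + 1) 0)

end TriForm

end

open TriForm

noncomputable section

namespace TriForm

variable {n : ℕ}

/-! ### Calculus of smooth germs -/

section Germs

variable {E : Type*} [NormedAddCommGroup E] [NormedSpace ℝ E]

/-! The proof turns generation of multi-indices into combinatorics, and then shows that in suitable
coordinates the iterated brackets are Taylor coefficients of the `f_i` up to lower order terms.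

Generation. Suppose `α` is proper at `j` and `β` has no entry beyond `j`. Then `α` generates `β`
exactly when every partial sum `α_1 + ⋯ + α_k` is at most that of `β` (`PsumLE`). For necessity, the
inverse `S` of a triangular change is triangular, so `S_1, …, S_k` vanish at the origin in the first
`k` variables alone, and `S^α` vanishes in these to order `psum k α` (`Generates.psumLE`). For
sufficiency, the change with inverse `exp (y_1 + ⋯ + y_i) - 1` has only nonnegative Taylor
coefficients, so nothing cancels and every dominating `β` occurs (`PsumLE.generates`). Hence the
essential set of `p` consists of the minimal proper indices of `p` for a well-founded partial order
(`mem_essentialSet_iff`).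

Brackets. In coordinates where the system is a lower triangular form, density and dimension force
every system flag to be the coordinate flag (`IsSystemFlag.eventually_eq_coordFlag`), and the
bracket conditions make `Y` triangular (`IsReducedTuple.isTriangularTuple`). At the origin, `ad_Y^α
f` then has vanishing components before the `i`-th. If all derivatives of `f_i` at strictly smaller
proper multi-indices vanish, its `i`-th component is a nonzero multiple of `∂^α f_i (0)`
(`isLeading_adMulti`). Such a triangular family of functionals detects the same minimal elements as
the derivatives themselves (`essentialSet_eq_iff`), which gives the equivalence for one fixed
admissible triple (`hasType_iff_bracketCondition`).

Invariance. Flags, tuples and brackets are carried along by pullback, and feedback only alters the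
unrestricted last component of the drift, so it can be dropped
(`FeedbackEquivalent.exists_coordinates`). The versions with "every" and "some" agree because the
coordinate flag provides an admissible triple (`IsInversePair.exists_admissible`). -/

theorem SmoothNear.congr {p q : (Fin n → ℝ) → E} (hp : SmoothNear p) (h : p =ᶠ[𝓝 0] q) :
    SmoothNear q := by
  filter_upwards [hp, h.eventuallyEq_nhds] with x hx hxy
  exact hx.congr_of_eventuallyEq hxy.symm

theorem SmoothNear.of_contDiff {p : (Fin n → ℝ) → E} (hp : ContDiff ℝ ∞ p) : SmoothNear p :=
  Eventually.of_forall fun _ => hp.contDiffAt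

theorem smoothNear_const (c : E) : SmoothNear (fun _ : Fin n → ℝ => c) :=
  .of_contDiff contDiff_const

theorem SmoothNear.add {p q : (Fin n → ℝ) → E} (hp : SmoothNear p) (hq : SmoothNear q) :
    SmoothNear (fun x => p x + q x) := by
  filter_upwards [hp, hq] with x h₁ h₂ using h₁.add h₂

theorem SmoothNear.sub {p q : (Fin n → ℝ) → E} (hp : SmoothNear p) (hq : SmoothNear q) :
    SmoothNear (fun x => p x - q x) := by
  filter_upwards [hp, hq] with x h₁ h₂ using h₁.sub h₂

theorem SmoothNear.mul {p q : (Fin n → ℝ) → ℝ} (hp : SmoothNear p) (hq : SmoothNear q) :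
    SmoothNear (fun x => p x * q x) := by
  filter_upwards [hp, hq] with x h₁ h₂ using h₁.mul h₂

theorem SmoothNear.sum {ι : Type*} (s : Finset ι) {p : ι → (Fin n → ℝ) → E}
    (hp : ∀ i ∈ s, SmoothNear (p i)) : SmoothNear (fun x => ∑ i ∈ s, p i x) := by
  have : ∀ᶠ x in 𝓝 (0 : Fin n → ℝ), ∀ i ∈ s, ContDiffAt ℝ ∞ (p i) x :=
    (Filter.eventually_all_finset s).2 hp
  filter_upwards [this] with x hx using ContDiffAt.sum hx

theorem SmoothNear.prod {ι : Type*} (s : Finset ι) {p : ι → (Fin n → ℝ) → ℝ}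
    (hp : ∀ i ∈ s, SmoothNear (p i)) : SmoothNear (fun x => ∏ i ∈ s, p i x) := by
  have : ∀ᶠ x in 𝓝 (0 : Fin n → ℝ), ∀ i ∈ s, ContDiffAt ℝ ∞ (p i) x :=
    (Filter.eventually_all_finset s).2 hp
  filter_upwards [this] with x hx using contDiffAt_prod hx

theorem SmoothNear.pow {p : (Fin n → ℝ) → ℝ} (hp : SmoothNear p) (m : ℕ) :
    SmoothNear (fun x => p x ^ m) := by
  filter_upwards [hp] with x h₁ using h₁.pow m

theorem SmoothNear.continuousAt {p : (Fin n → ℝ) → E} (hp : SmoothNear p) : ContinuousAt p 0 :=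
  hp.self_of_nhds.continuousAt

theorem smoothNear_pi {V : (Fin n → ℝ) → (Fin n → ℝ)} :
    SmoothNear V ↔ ∀ i, SmoothNear (fun x => V x i) := by
  simp only [SmoothNear, contDiffAt_pi, eventually_all]

theorem SmoothNear.comp {p : (Fin n → ℝ) → E} {S : (Fin n → ℝ) → (Fin n → ℝ)}
    (hp : SmoothNear p) (hS : SmoothNear S) (h0 : S 0 = 0) : SmoothNear (fun x => p (S x)) := by
  have ht : Tendsto S (𝓝 0) (𝓝 0) := by simpa [h0, ContinuousAt] using hS.continuousAt
  filter_upwards [ht.eventually hp, hS] with x h₁ h₂ using h₁.comp x h₂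

theorem tendsto_of_smoothNear {S : (Fin n → ℝ) → (Fin n → ℝ)} (hS : SmoothNear S)
    (h0 : S 0 = 0) : Tendsto S (𝓝 0) (𝓝 0) := by
  simpa [h0, ContinuousAt] using hS.continuousAt

theorem SmoothNear.fderiv {p : (Fin n → ℝ) → E} (hp : SmoothNear p) :
    SmoothNear (fun x => fderiv ℝ p x) := by
  filter_upwards [hp] with x hx using hx.fderiv_right (by simp)

theorem SmoothNear.fderiv_apply {p : (Fin n → ℝ) → E} {V : (Fin n → ℝ) → (Fin n → ℝ)}
    (hp : SmoothNear p) (hV : SmoothNear V) : SmoothNear (fun x => _root_.fderiv ℝ p x (V x)) := by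
  filter_upwards [hp.fderiv, hV] with x h₁ h₂ using h₁.clm_apply h₂

theorem SmoothNear.differentiable {p : (Fin n → ℝ) → E} (hp : SmoothNear p) :
    ∀ᶠ x in 𝓝 (0 : Fin n → ℝ), DifferentiableAt ℝ p x := by
  filter_upwards [hp] with x hx using hx.differentiableAt (by simp)

end Germs

/-! ### Partial derivatives of germs -/

theorem SmoothNear.partialD {p : (Fin n → ℝ) → ℝ} (hp : SmoothNear p) (k : Fin n) :
    SmoothNear (partialD k p) :=
  hp.fderiv_apply (smoothNear_const _)

theorem partialD_congr {p q : (Fin n → ℝ) → ℝ} (k : Fin n) (h : p =ᶠ[𝓝 0] q) :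
    partialD k p =ᶠ[𝓝 0] partialD k q := by
  filter_upwards [h.fderiv (𝕜 := ℝ)] with x hx
  simp [partialD, hx]

theorem partialD_const (k : Fin n) (c : ℝ) : partialD k (fun _ => c) = fun _ => 0 := by
  ext x; simp [partialD]

theorem partialD_congr_zero {p : (Fin n → ℝ) → ℝ} (k : Fin n) (h : p =ᶠ[𝓝 0] fun _ => 0) :
    partialD k p =ᶠ[𝓝 0] fun _ => 0 := by
  simpa [partialD_const] using partialD_congr k h

theorem partialD_add {p q : (Fin n → ℝ) → ℝ} (k : Fin n) (hp : SmoothNear p)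
    (hq : SmoothNear q) :
    partialD k (fun x => p x + q x) =ᶠ[𝓝 0] fun x => partialD k p x + partialD k q x := by
  filter_upwards [hp.differentiable, hq.differentiable] with x h₁ h₂
  simp [partialD, fderiv_fun_add h₁ h₂]

theorem partialD_mul {p q : (Fin n → ℝ) → ℝ} (k : Fin n) (hp : SmoothNear p)
    (hq : SmoothNear q) :
    partialD k (fun x => p x * q x) =ᶠ[𝓝 0]
      fun x => partialD k p x * q x + p x * partialD k q x := by
  filter_upwards [hp.differentiable, hq.differentiable] with x h₁ h₂
  simp [partialD, fderiv_fun_mul h₁ h₂]; ring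

theorem partialD_comm {p : (Fin n → ℝ) → ℝ} (k l : Fin n) (hp : SmoothNear p) :
    partialD k (partialD l p) =ᶠ[𝓝 0] partialD l (partialD k p) := by
  filter_upwards [hp, hp.fderiv.differentiable] with x h₁ h₂
  have hs : IsSymmSndFDerivAt ℝ p x := h₁.isSymmSndFDerivAt
    (by simpa using (show ((2 : ℕ∞) : WithTop ℕ∞) ≤ ∞ from mod_cast le_top))
  have key : ∀ a b : Fin n, partialD a (partialD b p) x
      = fderiv ℝ (fderiv ℝ p) x (Pi.single a 1) (Pi.single b 1) := by
    intro a b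
    have : partialD b p = fun y => (fderiv ℝ p y) (Pi.single b 1) := rfl
    rw [partialD, this, fderiv_clm_apply h₂ (differentiableAt_const _)]
    simp
  rw [key, key]
  exact hs.eq _ _

theorem fderiv_apply_eq_sum (p : (Fin n → ℝ) → ℝ) (x v : Fin n → ℝ) :
    fderiv ℝ p x v = ∑ m, v m * partialD m p x := by
  conv_lhs => rw [pi_eq_sum_univ' v]
  simp [partialD, map_sum]

theorem partialD_comp {p : (Fin n → ℝ) → ℝ} {S : (Fin n → ℝ) → (Fin n → ℝ)} (k : Fin n)
    (hp : SmoothNear p) (hS : SmoothNear S) (h0 : S 0 = 0) :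
    partialD k (fun x => p (S x)) =ᶠ[𝓝 0]
      fun x => ∑ m, partialD k (fun y => S y m) x * partialD m p (S x) := by
  filter_upwards [(tendsto_of_smoothNear hS h0).eventually hp.differentiable, hS.differentiable]
    with x h₁ h₂
  have h3 : fderiv ℝ (fun x => p (S x)) x = (fderiv ℝ p (S x)).comp (fderiv ℝ S x) :=
    fderiv_comp x h₁ h₂
  rw [partialD, h3, ContinuousLinearMap.comp_apply, fderiv_apply_eq_sum]
  refine Finset.sum_congr rfl fun m _ => ?_
  have h4 : fderiv ℝ (fun y => S y m) x = (ContinuousLinearMap.proj m).comp (fderiv ℝ S x) :=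
    fderiv_apply h₂ m
  simp [partialD, h4]

theorem partialD_coord (k i : Fin n) :
    partialD k (fun x : Fin n → ℝ => x i) = fun _ => if k = i then 1 else 0 := by
  ext x
  have : fderiv ℝ (fun x : Fin n → ℝ => x i) x = ContinuousLinearMap.proj i :=
    (ContinuousLinearMap.proj (R := ℝ) (φ := fun _ : Fin n => ℝ) i).fderiv
  rw [partialD, this]
  simp [Pi.single_apply, eq_comm]

theorem smoothNear_coord (i : Fin n) : SmoothNear (fun x : Fin n → ℝ => x i) :=
  .of_contDiff (contDiff_apply ℝ ℝ i)

theorem partialD_of_dependsOnFirst {h : (Fin n → ℝ) → ℝ} {k : ℕ} (hd : DependsOnFirst k h)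
    {j : Fin n} (hj : k ≤ j.val) : partialD j h =ᶠ[𝓝 0] fun _ => 0 := by
  obtain ⟨U, hU, hUh⟩ := hd
  filter_upwards [eventually_mem_nhds_iff.2 hU] with x hx
  by_cases hdx : DifferentiableAt ℝ h x
  · have hx0 : x ∈ U := mem_of_mem_nhds hx
    have hl : HasDerivAt (fun t : ℝ => x + t • (Pi.single j 1 : Fin n → ℝ)) (Pi.single j 1) 0 := by
      simpa using ((hasDerivAt_id (0 : ℝ)).smul_const (Pi.single j 1 : Fin n → ℝ)).const_add x
    have h1 : HasDerivAt (fun t : ℝ => h (x + t • (Pi.single j 1 : Fin n → ℝ)))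
        (fderiv ℝ h x (Pi.single j 1)) 0 := by
      have hf : HasFDerivAt h (fderiv ℝ h x) (x + (0 : ℝ) • (Pi.single j 1 : Fin n → ℝ)) := by
        simpa using hdx.hasFDerivAt
      exact hf.comp_hasDerivAt 0 hl
    have h2 : (fun t : ℝ => h (x + t • (Pi.single j 1 : Fin n → ℝ))) =ᶠ[𝓝 0] fun _ => h x := by
      have : Tendsto (fun t : ℝ => x + t • (Pi.single j 1 : Fin n → ℝ)) (𝓝 0) (𝓝 x) := by
        simpa [ContinuousAt] using hl.continuousAt
      filter_upwards [this.eventually hx] with t ht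
      refine hUh _ ht _ hx0 fun i hi => ?_
      have : i ≠ j := by rintro rfl; omega
      simp [this]
    have h3 := (h1.congr_of_eventuallyEq h2.symm).unique (hasDerivAt_const (0 : ℝ) (h x))
    simpa [partialD] using h3
  -- No smoothness is assumed; where `h` is not differentiable, `fderiv` takes its default value
  -- zero.
  · simp [partialD, fderiv_zero_of_not_differentiableAt hdx]

/-! ### Iterated partial derivatives -/

theorem multiIndex_induction {P : (Fin n → ℕ) → Prop} (h0 : P 0)
    (hs : ∀ α k, P α → P (α + Pi.single k 1)) (α : Fin n → ℕ) : P α := by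
  induction hN : ∑ k, α k generalizing α with
  | zero =>
    have : α = 0 := by ext k; simpa using (Finset.sum_eq_zero_iff.1 hN) k (Finset.mem_univ k)
    rwa [this]
  | succ N ih =>
    obtain ⟨k, -, hk⟩ : ∃ k ∈ Finset.univ, α k ≠ 0 := by
      by_contra! h
      rw [Finset.sum_eq_zero h] at hN
      omega
    have e : (α - Pi.single k 1) + Pi.single k 1 = α := by
      ext i
      by_cases hi : i = k
      · subst hi; simp; omega
      · simp [hi]
    rw [← e]
    apply hs
    apply ih
    have h2 : ∑ i, ((α - Pi.single k 1) + Pi.single k 1 : Fin n → ℕ) i = N + 1 := by rw [e, hN]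
    simp only [Pi.add_apply, Finset.sum_add_distrib, Finset.sum_pi_single', Finset.mem_univ,
      if_true] at h2
    omega

/-- Iterated partial derivatives along a list of directions. -/
def listD (l : List (Fin n)) (α : Fin n → ℕ) (p : (Fin n → ℝ) → ℝ) : (Fin n → ℝ) → ℝ :=
  l.foldr (fun k q => (partialD k)^[α k] q) p

theorem iterate_partialD_congr {p q : (Fin n → ℝ) → ℝ} (k : Fin n) (m : ℕ) (h : p =ᶠ[𝓝 0] q) :
    (partialD k)^[m] p =ᶠ[𝓝 0] (partialD k)^[m] q := by
  induction m with
  | zero => exact h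
  | succ m ih => simpa only [Function.iterate_succ_apply'] using partialD_congr k ih

theorem SmoothNear.iterate_partialD {p : (Fin n → ℝ) → ℝ} (hp : SmoothNear p) (k : Fin n)
    (m : ℕ) : SmoothNear ((TriForm.partialD k)^[m] p) := by
  induction m with
  | zero => exact hp
  | succ m ih => simpa only [Function.iterate_succ_apply'] using ih.partialD k

theorem iterate_partialD_comm {p : (Fin n → ℝ) → ℝ} (hp : SmoothNear p) (k a : Fin n) (m : ℕ) :
    (partialD a)^[m] (partialD k p) =ᶠ[𝓝 0] partialD k ((partialD a)^[m] p) := by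
  induction m with
  | zero => rfl
  | succ m ih =>
    simp only [Function.iterate_succ_apply']
    exact (partialD_congr a ih).trans (partialD_comm a k (hp.iterate_partialD a m))

theorem listD_congr {p q : (Fin n → ℝ) → ℝ} (l : List (Fin n)) (α : Fin n → ℕ)
    (h : p =ᶠ[𝓝 0] q) : listD l α p =ᶠ[𝓝 0] listD l α q := by
  induction l with
  | nil => exact h
  | cons a l ih => exact iterate_partialD_congr a _ ih

theorem SmoothNear.listD {p : (Fin n → ℝ) → ℝ} (hp : SmoothNear p) (l : List (Fin n))
    (α : Fin n → ℕ) : SmoothNear (listD l α p) := by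
  induction l with
  | nil => exact hp
  | cons a l ih => exact ih.iterate_partialD a _

theorem listD_partialD {p : (Fin n → ℝ) → ℝ} (hp : SmoothNear p) (l : List (Fin n))
    (α : Fin n → ℕ) (k : Fin n) : listD l α (partialD k p) =ᶠ[𝓝 0] partialD k (listD l α p) := by
  induction l with
  | nil => rfl
  | cons a l ih =>
    exact (iterate_partialD_congr a _ ih).trans (iterate_partialD_comm (hp.listD l α) k a _)

theorem listD_add_single_of_notMem (p : (Fin n → ℝ) → ℝ) {l : List (Fin n)}
    (α : Fin n → ℕ) {k : Fin n} (hk : k ∉ l) : listD l (α + Pi.single k 1) p = listD l α p := by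
  induction l with
  | nil => rfl
  | cons a l ih =>
    simp only [List.mem_cons, not_or] at hk
    have : (α + Pi.single k 1 : Fin n → ℕ) a = α a := by simp [Ne.symm hk.1]
    simp only [listD, List.foldr_cons, this]
    exact congrArg _ (ih hk.2)

theorem listD_add_single {p : (Fin n → ℝ) → ℝ} (hp : SmoothNear p) {l : List (Fin n)}
    (hl : l.Nodup) (α : Fin n → ℕ) {k : Fin n} (hk : k ∈ l) :
    listD l (α + Pi.single k 1) p =ᶠ[𝓝 0] partialD k (listD l α p) := by
  induction l with
  | nil => simp at hk
  | cons a l ih =>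
    rw [List.nodup_cons] at hl
    by_cases hak : a = k
    · subst hak
      have h1 := listD_add_single_of_notMem p α hl.1
      have h2 : listD (a :: l) (α + Pi.single a 1) p
          = (partialD a)^[α a + 1] (listD l (α + Pi.single a 1) p) := by
        simp [listD]
      rw [h2, h1, Function.iterate_succ_apply']
      rfl
    · have hkl : k ∈ l := by simpa [Ne.symm hak] using hk
      have h2 : listD (a :: l) (α + Pi.single k 1) p
          = (partialD a)^[α a] (listD l (α + Pi.single k 1) p) := by
        simp [listD, hak]
      rw [h2]
      exact (iterate_partialD_congr a _ (ih hl.2 hkl)).trans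
        (iterate_partialD_comm (hp.listD l α) k a _)

theorem multiD_congr {p q : (Fin n → ℝ) → ℝ} (α : Fin n → ℕ) (h : p =ᶠ[𝓝 0] q) :
    multiD α p =ᶠ[𝓝 0] multiD α q :=
  listD_congr _ α h

theorem multiD_congr_zero {p q : (Fin n → ℝ) → ℝ} (α : Fin n → ℕ) (h : p =ᶠ[𝓝 0] q) :
    multiD α p 0 = multiD α q 0 :=
  (multiD_congr α h).self_of_nhds

/-- By symmetry of second derivatives the extra derivative may be taken innermost. This recursion
drives the later inductions on multi-indices. -/
theorem multiD_add_single {p : (Fin n → ℝ) → ℝ} (hp : SmoothNear p) (α : Fin n → ℕ)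
    (k : Fin n) : multiD (α + Pi.single k 1) p 0 = multiD α (partialD k p) 0 :=
  ((listD_add_single hp (List.nodup_finRange n) α (List.mem_finRange k)).trans
    (listD_partialD hp _ α k).symm).self_of_nhds

theorem multiD_zero (p : (Fin n → ℝ) → ℝ) : multiD 0 p = p := by
  have : ∀ l : List (Fin n), listD l 0 p = p := by
    intro l
    induction l with
    | nil => rfl
    | cons a l ih => exact ih
  exact this _

theorem multiD_fun_zero (α : Fin n → ℕ) : multiD α (fun _ : Fin n → ℝ => (0 : ℝ)) 0 = 0 := by
  induction α using multiIndex_induction with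
  | h0 => simp [multiD_zero]
  | hs α k ih => rw [multiD_add_single (smoothNear_const 0), partialD_const, ih]

theorem multiD_add {p q : (Fin n → ℝ) → ℝ} (α : Fin n → ℕ) (hp : SmoothNear p)
    (hq : SmoothNear q) :
    multiD α (fun x => p x + q x) 0 = multiD α p 0 + multiD α q 0 := by
  induction α using multiIndex_induction generalizing p q with
  | h0 => simp [multiD_zero]
  | hs α k ih =>
    rw [multiD_add_single (hp.add hq), multiD_add_single hp, multiD_add_single hq,
      multiD_congr_zero α (partialD_add k hp hq), ih (hp.partialD k) (hq.partialD k)]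

theorem multiD_const_mul {p : (Fin n → ℝ) → ℝ} (α : Fin n → ℕ) (c : ℝ) (hp : SmoothNear p) :
    multiD α (fun x => c * p x) 0 = c * multiD α p 0 := by
  induction α using multiIndex_induction generalizing p with
  | h0 => simp [multiD_zero]
  | hs α k ih =>
    have h : partialD k (fun x => c * p x) =ᶠ[𝓝 0] fun x => c * partialD k p x := by
      filter_upwards [partialD_mul k (smoothNear_const c) hp] with x hx
      simpa [partialD_const] using hx
    rw [multiD_add_single ((smoothNear_const c).mul hp), multiD_add_single hp,
      multiD_congr_zero α h, ih (hp.partialD k)]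

theorem multiD_sum {ι : Type*} (s : Finset ι) {p : ι → (Fin n → ℝ) → ℝ} (α : Fin n → ℕ)
    (hp : ∀ i, SmoothNear (p i)) :
    multiD α (fun x => ∑ i ∈ s, p i x) 0 = ∑ i ∈ s, multiD α (p i) 0 := by
  classical
  induction s using Finset.induction_on with
  | empty => simpa using multiD_fun_zero α
  | insert a s ha ih =>
    simp only [Finset.sum_insert ha]
    rw [multiD_add α (hp a) (SmoothNear.sum s fun i _ => hp i), ih]

theorem exists_eq_add_single {β : Fin n → ℕ} {k : Fin n} (hk : β k ≠ 0) :
    ∃ γ : Fin n → ℕ, β = γ + Pi.single k 1 := by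
  refine ⟨β - Pi.single k 1, ?_⟩
  ext i
  by_cases hi : i = k
  · subst hi; simp; omega
  · simp [hi]

theorem multiD_eq_zero_of_partialD {p : (Fin n → ℝ) → ℝ} (hp : SmoothNear p) {k : Fin n}
    (h : partialD k p =ᶠ[𝓝 0] fun _ => 0) {β : Fin n → ℕ} (hk : β k ≠ 0) : multiD β p 0 = 0 := by
  obtain ⟨γ, rfl⟩ := exists_eq_add_single hk
  rw [multiD_add_single hp, multiD_congr_zero γ h, multiD_fun_zero]

/-! ### Partial sums of multi-indices -/

/-- The sum of the first `k` entries. -/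
def psum {M : Type*} [AddCommMonoid M] (k : ℕ) (α : Fin n → M) : M :=
  ∑ l : Fin n, if l.val < k then α l else 0

theorem psum_zero {M : Type*} [AddCommMonoid M] (α : Fin n → M) : psum 0 α = 0 := by simp [psum]

theorem psum_succ {M : Type*} [AddCommMonoid M] (k : Fin n) (α : Fin n → M) :
    psum (k.val + 1) α = psum k.val α + α k := by
  have h : α k = ∑ l : Fin n, if l = k then α l else 0 := by simp
  rw [h, psum, psum, ← Finset.sum_add_distrib]
  refine Finset.sum_congr rfl fun l _ => ?_
  rcases lt_trichotomy l k with h | h | h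
  · have : l.val < k.val := h
    simp [this, h.ne, this.trans (Nat.lt_succ_self _)]
  · subst h; simp
  · have : k.val < l.val := h
    simp [h.ne', show ¬ l.val < k.val + 1 by omega, show ¬ l.val < k.val by omega]

theorem psum_add (k : ℕ) (α β : Fin n → ℕ) : psum k (α + β) = psum k α + psum k β := by
  simp only [psum, ← Finset.sum_add_distrib]
  refine Finset.sum_congr rfl fun l _ => ?_
  split_ifs <;> simp

theorem psum_single (k : ℕ) (m : Fin n) :
    psum k (Pi.single m 1 : Fin n → ℕ) = if m.val < k then 1 else 0 := by
  rw [psum, Finset.sum_eq_single m]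
  · simp
  · intro b _ hb; simp [hb]
  · simp

theorem psum_mono (k : ℕ) {α β : Fin n → ℕ} (h : α ≤ β) : psum k α ≤ psum k β := by
  refine Finset.sum_le_sum fun l _ => ?_
  split_ifs
  · exact h l
  · rfl

theorem psum_total (α : Fin n → ℕ) : psum n α = ∑ l, α l := by simp [psum]

theorem psum_eq_zero {k : ℕ} {α : Fin n → ℕ} (h : ∀ l : Fin n, l.val < k → α l = 0) :
    psum k α = 0 := by
  refine Finset.sum_eq_zero fun l _ => ?_
  split_ifs with hl
  · exact h l hl
  · rfl

theorem le_psum {k : ℕ} (α : Fin n → ℕ) {l : Fin n} (hl : l.val < k) : α l ≤ psum k α := by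
  have := Finset.single_le_sum (f := fun l : Fin n => if l.val < k then α l else 0)
    (fun i _ => Nat.zero_le _) (Finset.mem_univ l)
  simpa [hl, psum] using this

/-- The order on multi-indices given by comparing all partial sums. -/
def PsumLE (α β : Fin n → ℕ) : Prop := ∀ k : ℕ, psum k α ≤ psum k β

theorem PsumLE.refl (α : Fin n → ℕ) : PsumLE α α := fun _ => le_rfl

theorem PsumLE.trans {α β γ : Fin n → ℕ} (h₁ : PsumLE α β) (h₂ : PsumLE β γ) : PsumLE α γ :=
  fun k => (h₁ k).trans (h₂ k)

theorem PsumLE.antisymm {α β : Fin n → ℕ} (h₁ : PsumLE α β) (h₂ : PsumLE β α) : α = β := by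
  ext k
  have e : ∀ k, psum k α = psum k β := fun k => le_antisymm (h₁ k) (h₂ k)
  have a := psum_succ k α
  have b := psum_succ k β
  rw [e, e] at a
  omega

theorem psumLE_of_le {α β : Fin n → ℕ} (h : α ≤ β) : PsumLE α β := fun k => psum_mono k h

theorem sum_lt_sum_of_le_of_ne {γ β : Fin n → ℕ} (h : γ ≤ β) (hne : γ ≠ β) :
    psum n γ < psum n β := by
  rw [psum_total, psum_total]
  obtain ⟨i, hi⟩ := Function.ne_iff.1 hne
  exact Finset.sum_lt_sum (fun l _ => h l) ⟨i, Finset.mem_univ i, lt_of_le_of_ne (h i) hi⟩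

theorem exists_first {α : Fin n → ℕ} (h : α ≠ 0) : ∃ i, α i ≠ 0 ∧ ∀ l < i, α l = 0 := by
  obtain ⟨i, hi⟩ := Function.ne_iff.1 h
  obtain ⟨m, hm, hmin⟩ := (inferInstance : WellFoundedLT (Fin n)).wf.has_min {i | α i ≠ 0} ⟨i, hi⟩
  exact ⟨m, hm, fun l hl => by_contra fun hne => hmin l hne hl⟩

/-- The sum of all partial sums is strictly monotone for the partial sum order. -/
theorem sum_psum_lt {α β : Fin n → ℕ} (h : PsumLE α β) (hne : α ≠ β) :
    ∑ k ∈ Finset.range (n + 1), psum k α < ∑ k ∈ Finset.range (n + 1), psum k β := by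
  refine Finset.sum_lt_sum (fun k _ => h k) ?_
  by_contra! hc
  refine hne (h.antisymm fun k => ?_)
  by_cases hk : k ≤ n
  · exact hc k (by simp; omega)
  · have : ∀ γ : Fin n → ℕ, psum k γ = psum n γ := fun γ =>
      Finset.sum_congr rfl fun l _ => by simp [show l.val < k by omega]
    rw [this, this]
    exact hc n (by simp)

/-- A nonempty set of multi-indices has a minimal element below each of its elements. -/
theorem exists_minimal_psumLE {I : Set (Fin n → ℕ)} {α : Fin n → ℕ} (hα : α ∈ I) :
    ∃ β ∈ I, PsumLE β α ∧ ∀ γ ∈ I, PsumLE γ β → γ = β := by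
  induction hN : ∑ k ∈ Finset.range (n + 1), psum k α using Nat.strong_induction_on
    generalizing α with
  | _ N ih =>
    by_cases h : ∀ γ ∈ I, PsumLE γ α → γ = α
    · exact ⟨α, hα, .refl α, h⟩
    · push Not at h
      obtain ⟨γ, hγ, hle, hne⟩ := h
      obtain ⟨β, hβ, hβγ, hmin⟩ := ih _ (hN ▸ sum_psum_lt hle hne) hγ rfl
      exact ⟨β, hβ, hβγ.trans hle, hmin⟩

/-! ### Consequences of the Leibniz rule -/

theorem multiD_mul_add_single {p q : (Fin n → ℝ) → ℝ} (hp : SmoothNear p) (hq : SmoothNear q)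
    (β : Fin n → ℕ) (k : Fin n) :
    multiD (β + Pi.single k 1) (fun x => p x * q x) 0
      = multiD β (fun x => partialD k p x * q x) 0
        + multiD β (fun x => p x * partialD k q x) 0 := by
  rw [multiD_add_single (hp.mul hq), multiD_congr_zero β (partialD_mul k hp hq),
    multiD_add β ((hp.partialD k).mul hq) (hp.mul (hq.partialD k))]

/-- Every other Leibniz term contains a strictly lower derivative of `q`. -/
theorem multiD_mul_of_vanishing {p q : (Fin n → ℝ) → ℝ} (hp : SmoothNear p) (hq : SmoothNear q)
    (β : Fin n → ℕ) (h : ∀ γ ≤ β, γ ≠ β → multiD γ q 0 = 0) :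
    multiD β (fun x => p x * q x) 0 = p 0 * multiD β q 0 := by
  induction β using multiIndex_induction generalizing p q with
  | h0 => simp [multiD_zero]
  | hs β k ih =>
    have hle : β ≤ β + Pi.single k 1 := fun i => by simp
    have hne : ∀ γ ≤ β, γ ≠ β + Pi.single k 1 := by
      rintro γ hγ rfl
      have := hγ k
      simp at this
    rw [multiD_mul_add_single hp hq, ih (hp.partialD k) hq
      fun γ hγ _ => h γ (hγ.trans hle) (hne γ hγ), h β hle (hne β le_rfl),
      ih hp (hq.partialD k), ← multiD_add_single hq]
    · simp
    · intro γ hγ hγβ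
      rw [← multiD_add_single hq]
      refine h _ (fun i => ?_) fun e => hγβ ?_
      · simpa using hγ i
      · simpa using e

/-- `φ` vanishes at the origin to order `a` in the first `k` variables, as a formal Taylor series. -/
def VanishesTo (k a : ℕ) (φ : (Fin n → ℝ) → ℝ) : Prop :=
  ∀ γ : Fin n → ℕ, psum k γ < a → multiD γ φ 0 = 0

/-- A derivative lowers the order of vanishing by one if its direction is among the first `k`, and
by nothing otherwise, so the bound survives each Leibniz step. -/
theorem VanishesTo.mul {k a b : ℕ} {φ ψ : (Fin n → ℝ) → ℝ} (hφs : SmoothNear φ)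
    (hψs : SmoothNear ψ) (hφ : VanishesTo k a φ) (hψ : VanishesTo k b ψ) :
    VanishesTo k (a + b) (fun x => φ x * ψ x) := by
  intro γ
  induction γ using multiIndex_induction generalizing a b φ ψ with
  | h0 =>
    intro h
    have h0 : psum k (0 : Fin n → ℕ) = 0 := psum_eq_zero fun _ _ => rfl
    rcases Nat.eq_zero_or_pos a with ha | ha
    · have := hψ 0 (by omega)
      rw [multiD_zero] at this ⊢
      simp [this]
    · have := hφ 0 (by omega)
      rw [multiD_zero] at this ⊢
      simp [this]
  | hs γ l ih =>
    intro h
    have der : ∀ {a : ℕ} {φ : (Fin n → ℝ) → ℝ}, SmoothNear φ → VanishesTo k a φ →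
        VanishesTo k (a - if l.val < k then 1 else 0) (partialD l φ) := by
      intro a φ hs hv δ hδ
      rw [← multiD_add_single hs]
      apply hv
      rw [psum_add, psum_single]
      omega
    rw [psum_add, psum_single] at h
    rw [multiD_mul_add_single hφs hψs,
      ih (hφs.partialD l) hψs (der hφs hφ) hψ (by omega),
      ih hφs (hψs.partialD l) hφ (der hψs hψ) (by omega), add_zero]

theorem VanishesTo.pow {k a : ℕ} {φ : (Fin n → ℝ) → ℝ} (hφs : SmoothNear φ)
    (hφ : VanishesTo k a φ) (m : ℕ) : VanishesTo k (a * m) (fun x => φ x ^ m) := by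
  induction m with
  | zero => intro γ h; simp at h
  | succ m ih =>
    simp only [pow_succ, Nat.mul_succ]
    exact ih.mul (hφs.pow m) hφs hφ

theorem VanishesTo.prod {ι : Type*} (s : Finset ι) {k : ℕ} {a : ι → ℕ}
    {φ : ι → (Fin n → ℝ) → ℝ} (hφs : ∀ i, SmoothNear (φ i)) (hφ : ∀ i, VanishesTo k (a i) (φ i)) :
    VanishesTo k (∑ i ∈ s, a i) (fun x => ∏ i ∈ s, φ i x) := by
  classical
  induction s using Finset.induction_on with
  | empty => intro γ h; simp at h
  | insert i s hi ih =>
    simp only [Finset.prod_insert hi, Finset.sum_insert hi]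
    exact (hφ i).mul (hφs i) (SmoothNear.prod s fun i _ => hφs i) ih

/-- All Taylor coefficients at the origin are nonnegative. -/
structure NonnegDerivs (φ : (Fin n → ℝ) → ℝ) : Prop where
  smooth : SmoothNear φ
  nonneg : ∀ δ, 0 ≤ multiD δ φ 0

theorem NonnegDerivs.partialD {φ : (Fin n → ℝ) → ℝ} (h : NonnegDerivs φ) (k : Fin n) :
    NonnegDerivs (partialD k φ) :=
  ⟨h.smooth.partialD k, fun δ => by rw [← multiD_add_single h.smooth]; exact h.nonneg _⟩

theorem NonnegDerivs.mul {φ ψ : (Fin n → ℝ) → ℝ} (hφ : NonnegDerivs φ) (hψ : NonnegDerivs ψ) :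
    NonnegDerivs (fun x => φ x * ψ x) := by
  refine ⟨hφ.smooth.mul hψ.smooth, fun δ => ?_⟩
  induction δ using multiIndex_induction generalizing φ ψ with
  | h0 =>
    have h1 := hφ.nonneg 0
    have h2 := hψ.nonneg 0
    rw [multiD_zero] at *
    positivity
  | hs δ k ih =>
    rw [multiD_mul_add_single hφ.smooth hψ.smooth]
    exact add_nonneg (ih (hφ.partialD k) hψ) (ih hφ (hψ.partialD k))

theorem NonnegDerivs.const {c : ℝ} (hc : 0 ≤ c) : NonnegDerivs (fun _ : Fin n → ℝ => c) := by
  refine ⟨smoothNear_const c, fun δ => ?_⟩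
  induction δ using multiIndex_induction with
  | h0 => simpa [multiD_zero] using hc
  | hs δ k ih => rw [multiD_add_single (smoothNear_const c), partialD_const, multiD_fun_zero]

theorem NonnegDerivs.pow {φ : (Fin n → ℝ) → ℝ} (h : NonnegDerivs φ) (m : ℕ) :
    NonnegDerivs (fun x => φ x ^ m) := by
  induction m with
  | zero => simpa using NonnegDerivs.const (n := n) zero_le_one
  | succ m ih => simpa only [pow_succ] using ih.mul h

theorem NonnegDerivs.prod {ι : Type*} (s : Finset ι) {φ : ι → (Fin n → ℝ) → ℝ}
    (h : ∀ i, NonnegDerivs (φ i)) : NonnegDerivs (fun x => ∏ i ∈ s, φ i x) := by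
  classical
  induction s using Finset.induction_on with
  | empty => simpa using NonnegDerivs.const (n := n) zero_le_one
  | insert i s hi ih => simpa only [Finset.prod_insert hi] using (h i).mul ih

/-- With nonnegative coefficients nothing cancels, so one positive Leibniz term is enough. -/
theorem NonnegDerivs.mul_pos {φ ψ : (Fin n → ℝ) → ℝ} (hφ : NonnegDerivs φ) (hψ : NonnegDerivs ψ)
    {a b : Fin n → ℕ} (ha : 0 < multiD a φ 0) (hb : 0 < multiD b ψ 0) :
    0 < multiD (a + b) (fun x => φ x * ψ x) 0 := by
  induction a using multiIndex_induction generalizing φ with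
  | h0 =>
    rw [zero_add]
    rw [multiD_zero] at ha
    induction b using multiIndex_induction generalizing ψ with
    | h0 => rw [multiD_zero] at *; positivity
    | hs b k ih =>
      rw [multiD_mul_add_single hφ.smooth hψ.smooth]
      exact add_pos_of_nonneg_of_pos (((hφ.partialD k).mul hψ).nonneg b)
        (ih (hψ.partialD k) (by rwa [← multiD_add_single hψ.smooth]))
  | hs a k ih =>
    rw [add_right_comm, multiD_mul_add_single hφ.smooth hψ.smooth]
    exact add_pos_of_pos_of_nonneg
      (ih (hφ.partialD k) (by rwa [← multiD_add_single hφ.smooth]))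
      ((hφ.mul (hψ.partialD k)).nonneg _)

theorem prod_pow_add_single (S : Fin n → ℝ) (α : Fin n → ℕ) (i : Fin n) :
    ∏ l, S l ^ (α + Pi.single i 1 : Fin n → ℕ) l = (∏ l, S l ^ α l) * S i := by
  simp only [Pi.add_apply, pow_add, Finset.prod_mul_distrib]
  congr 1
  rw [Finset.prod_eq_single i]
  · simp
  · intro b _ hb; simp [hb]
  · simp

/-- The value is `β!`, but only its sign is needed. -/
theorem multiD_monomial_pos (β : Fin n → ℕ) : 0 < multiD β (monomial β) 0 := by
  have hc : ∀ i, NonnegDerivs (fun x : Fin n → ℝ => x i) := by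
    refine fun i => ⟨smoothNear_coord i, fun δ => ?_⟩
    induction δ using multiIndex_induction with
    | h0 => simp [multiD_zero]
    | hs δ k _ =>
      rw [multiD_add_single (smoothNear_coord i), partialD_coord]
      exact (NonnegDerivs.const (by split_ifs <;> norm_num)).nonneg δ
  induction β using multiIndex_induction with
  | h0 => rw [multiD_zero]; simp [monomial]
  | hs β k ih =>
    have e : monomial (β + Pi.single k 1) = fun x : Fin n → ℝ => monomial β x * x k := by
      ext x; exact prod_pow_add_single x β k
    rw [e]
    refine NonnegDerivs.mul_pos (NonnegDerivs.prod _ fun i => (hc i).pow _) (hc k) ih ?_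
    rw [← zero_add (Pi.single k 1), multiD_add_single (smoothNear_coord k), partialD_coord,
      multiD_zero]
    simp

theorem smoothNear_monomial_comp (α : Fin n → ℕ) {S : (Fin n → ℝ) → (Fin n → ℝ)}
    (hS : SmoothNear S) : SmoothNear (fun y => monomial α (S y)) :=
  SmoothNear.prod _ fun i _ => (smoothNear_pi.1 hS i).pow _

/-! ### Generation of multi-indices -/

/-- A product of powers of series `S i`, each having all monomials in the first `i` variables with
positive coefficients, has a positive coefficient at every multi-index dominating `α`. -/
theorem multiD_prod_pow_pos {S : Fin n → (Fin n → ℝ) → ℝ} (hS : ∀ i, NonnegDerivs (S i))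
    (hpos : ∀ i γ, γ ≠ 0 → (∀ k, i < k → γ k = 0) → 0 < multiD γ (S i) 0) {j : Fin n}
    {α β : Fin n → ℕ} (hα : IsProperAt j α) (hβ : ∀ k, j < k → β k = 0) (h : PsumLE α β) :
    0 < multiD β (fun y => ∏ i, S i y ^ α i) 0 := by
  induction hN : psum n α using Nat.strong_induction_on generalizing α β with
  | _ N ih =>
    have hα0 : α ≠ 0 := fun h0 => by simpa [h0] using hα.1
    -- Split off one factor `S i` for the first variable of `α` and let it contribute a single `y
    -- m`, the first variable of `β`. Domination gives `m ≤ i`, so `S i` contains `y m`.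
    obtain ⟨i, hi, hilt⟩ := exists_first hα0
    have hβ0 : β ≠ 0 := by
      rintro rfl
      have h1 := h (j.val + 1)
      have h2 := le_psum α (Nat.lt_succ_self j.val)
      have h3 : psum (j.val + 1) (0 : Fin n → ℕ) = 0 := psum_eq_zero fun _ _ => rfl
      have := hα.1
      simp only [Nat.succ_eq_add_one] at h2
      omega
    obtain ⟨m, hm, hmlt⟩ := exists_first hβ0
    have hij : i ≤ j := by
      by_contra hc
      exact hi (hα.2 i (not_le.1 hc))
    have hmi : m.val ≤ i.val := by
      by_contra hc
      have h1 := h (i.val + 1)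
      have h2 := le_psum α (Nat.lt_succ_self i.val)
      have h3 : psum (i.val + 1) β = 0 := psum_eq_zero fun l hl => hmlt l (by
        rw [Fin.lt_def]; omega)
      simp only [Nat.succ_eq_add_one] at h2
      omega
    have hzα : ∀ k ≤ i.val, psum k α = 0 := fun k hk =>
      psum_eq_zero fun l hl => hilt l (by rw [Fin.lt_def]; omega)
    obtain ⟨α', rfl⟩ := exists_eq_add_single hi
    -- The last remaining factor is `S j`; it absorbs all of `β`, whose degree may exceed that of
    -- `α`.
    by_cases hα' : α' = 0
    · subst hα'
      have e : (fun y => ∏ l, S l y ^ (0 + Pi.single i 1 : Fin n → ℕ) l) = S i := by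
        ext y
        rw [prod_pow_add_single (fun l => S l y)]
        simp
      rw [e]
      have : i = j := by
        by_contra hne
        have := hα.1
        simp [Ne.symm hne] at this
      subst this
      exact hpos i β hβ0 hβ
    obtain ⟨β', rfl⟩ := exists_eq_add_single hm
    have e : (fun y => ∏ l, S l y ^ (α' + Pi.single i 1 : Fin n → ℕ) l)
        = fun y => (∏ l, S l y ^ α' l) * S i y := by
      ext y
      exact prod_pow_add_single (fun l => S l y) α' i
    rw [e]
    refine NonnegDerivs.mul_pos (NonnegDerivs.prod _ fun l => (hS l).pow _) (hS i) ?_ ?_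
    · refine ih (psum n α') ?_ ⟨?_, ?_⟩ ?_ ?_ rfl
      · rw [← hN, psum_add, psum_single]
        simp
      · by_cases hne : i = j
        · subst hne
          obtain ⟨l, hl⟩ := Function.ne_iff.1 hα'
          rcases lt_trichotomy l i with h1 | h1 | h1
          · have := hilt l h1
            simp only [Pi.add_apply, Nat.add_eq_zero_iff] at this
            exact absurd this.1 hl
          · subst h1; exact Nat.one_le_iff_ne_zero.2 hl
          · have := hα.2 l h1
            simp only [Pi.add_apply, Nat.add_eq_zero_iff] at this
            exact absurd this.1 hl
        · have := hα.1
          simpa [Ne.symm hne] using this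
      · intro k hk
        have := hα.2 k hk
        simp only [Pi.add_apply, Nat.add_eq_zero_iff] at this
        exact this.1
      · intro k hk
        have := hβ k hk
        simp only [Pi.add_apply, Nat.add_eq_zero_iff] at this
        exact this.1
      -- Domination persists: for `k` beyond `i` both partial sums drop by one, while for `k ≤ i`
      -- that of `α` is zero.
      · intro k
        have h1 := h k
        have h2 := hzα k
        simp only [psum_add, psum_single] at h1 h2
        split_ifs at h1 h2 <;> omega
    · refine hpos i _ (fun h0 => ?_) fun k hk => ?_
      · have := congrFun h0 m
        simp at this
      · have : k ≠ m := by rintro rfl; rw [Fin.lt_def] at hk; omega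
        simp [this]

/-! ### An explicit triangular change with positive Taylor coefficients -/

/-- `y ↦ exp (y_1 + ⋯ + y_i) - 1`. -/
def expSum (y : Fin n → ℝ) (i : Fin n) : ℝ := Real.exp (psum (i.val + 1) y) - 1

/-- The inverse of `expSum`. -/
def logDiff (x : Fin n → ℝ) (i : Fin n) : ℝ :=
  Real.log (1 + x i) - if h : 0 < i.val then Real.log (1 + x ⟨i.val - 1, by omega⟩) else 0

theorem contDiff_psum (k : ℕ) : ContDiff ℝ ∞ (fun y : Fin n → ℝ => psum k y) := by
  refine ContDiff.sum fun l _ => ?_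
  split_ifs
  · exact contDiff_apply ℝ ℝ l
  · exact contDiff_const

theorem partialD_exp_psum (k : Fin n) (m : ℕ) :
    partialD k (fun y : Fin n → ℝ => Real.exp (psum m y))
      = fun y => (if k.val < m then 1 else 0) * Real.exp (psum m y) := by
  have hlin : ∀ y : Fin n → ℝ, HasFDerivAt (fun y : Fin n → ℝ => psum m y)
      (∑ l : Fin n, if l.val < m then ContinuousLinearMap.proj (R := ℝ) (φ := fun _ => ℝ) l
        else 0) y := by
    intro y
    refine HasFDerivAt.fun_sum fun l _ => ?_
    split_ifs
    · exact (ContinuousLinearMap.proj (R := ℝ) (φ := fun _ => ℝ) l).hasFDerivAt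
    · exact hasFDerivAt_const _ _
  ext y
  rw [partialD, (hlin y).exp.fderiv]
  simp only [smul_apply, _root_.sum_apply, smul_eq_mul]
  rw [Finset.sum_eq_single k]
  · split_ifs <;> simp
  · intro b _ hb
    split_ifs <;> simp [hb]
  · simp

theorem smoothNear_exp_psum (m : ℕ) : SmoothNear (fun y : Fin n → ℝ => Real.exp (psum m y)) :=
  .of_contDiff (contDiff_psum m).exp

theorem smoothNear_expSum : SmoothNear (expSum (n := n)) :=
  smoothNear_pi.2 fun _ => (smoothNear_exp_psum _).sub (smoothNear_const 1)

theorem smoothNear_logDiff : SmoothNear (logDiff (n := n)) := by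
  have h : ∀ i : Fin n, SmoothNear (fun x : Fin n → ℝ => Real.log (1 + x i)) := by
    intro i
    have hc : Continuous fun x : Fin n → ℝ => 1 + x i := by fun_prop
    have h1 : ∀ᶠ x in 𝓝 (0 : Fin n → ℝ), 1 + x i ≠ 0 :=
      hc.continuousAt.eventually_ne (by simp)
    filter_upwards [h1, (smoothNear_const (1 : ℝ)).add (smoothNear_coord i)] with x hx hs
    exact hs.log hx
  refine smoothNear_pi.2 fun i => (h i).sub ?_
  by_cases hi : 0 < i.val
  · simpa [hi] using h _
  · simpa [hi] using smoothNear_const (0 : ℝ)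

theorem logDiff_expSum (y : Fin n → ℝ) : logDiff (expSum y) = y := by
  ext i
  have h := psum_succ i y
  simp only [logDiff, expSum, add_sub_cancel, Real.log_exp]
  split_ifs with hi
  · rw [Nat.sub_add_cancel hi, h]; ring
  · have : i.val = 0 := by omega
    rw [h, this, psum_zero]; ring

theorem psum_logDiff (x : Fin n → ℝ) (i : Fin n) :
    psum (i.val + 1) (logDiff x) = Real.log (1 + x i) := by
  obtain ⟨i, hi⟩ := i
  induction i with
  | zero => rw [psum_succ ⟨0, hi⟩, psum_zero]; simp [logDiff]
  | succ i ih =>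
    rw [psum_succ ⟨i + 1, hi⟩]
    have := ih (by omega)
    simp only at this ⊢
    rw [this]
    simp [logDiff]

theorem expSum_logDiff : ∀ᶠ x in 𝓝 (0 : Fin n → ℝ), expSum (logDiff x) = x := by
  have h : ∀ᶠ x in 𝓝 (0 : Fin n → ℝ), ∀ i, 0 < 1 + x i := by
    refine eventually_all.2 fun i => ?_
    have hc : Continuous fun x : Fin n → ℝ => 1 + x i := by fun_prop
    exact hc.continuousAt.eventually_const_lt (by simp)
  filter_upwards [h] with x hx
  ext i
  rw [expSum, psum_logDiff, Real.exp_log (hx i)]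
  ring

theorem isLowerTriangularCoordChange_logDiff :
    IsLowerTriangularCoordChange (logDiff (n := n)) := by
  refine ⟨⟨smoothNear_logDiff, ?_, expSum, smoothNear_expSum, ?_, expSum_logDiff,
    Eventually.of_forall logDiff_expSum⟩, fun i => ⟨Set.univ, univ_mem, fun x _ y _ h => ?_⟩⟩
  · ext i; simp [logDiff]
  · ext i; simp [expSum, psum]
  · simp only [logDiff]
    rw [h i (Nat.lt_succ_self _)]
    split_ifs with hi
    · rw [h ⟨i.val - 1, by omega⟩ (by simp)]
    · rfl

theorem nonnegDerivs_exp_psum (m : ℕ) :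
    NonnegDerivs (fun y : Fin n → ℝ => Real.exp (psum m y)) := by
  refine ⟨smoothNear_exp_psum m, fun δ => ?_⟩
  induction δ using multiIndex_induction with
  | h0 => rw [multiD_zero]; positivity
  | hs δ k ih =>
    rw [multiD_add_single (smoothNear_exp_psum m), partialD_exp_psum,
      multiD_const_mul _ _ (smoothNear_exp_psum m)]
    split_ifs <;> simp [ih]

theorem multiD_exp_psum_pos (m : ℕ) {γ : Fin n → ℕ} (h : ∀ k : Fin n, m ≤ k.val → γ k = 0) :
    0 < multiD γ (fun y : Fin n → ℝ => Real.exp (psum m y)) 0 := by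
  induction γ using multiIndex_induction with
  | h0 => rw [multiD_zero]; positivity
  | hs δ k ih =>
    have hk : k.val < m := by
      by_contra hc
      have := h k (by omega)
      simp at this
    rw [multiD_add_single (smoothNear_exp_psum m), partialD_exp_psum,
      multiD_const_mul _ _ (smoothNear_exp_psum m)]
    simp only [hk, if_true, one_mul]
    refine ih fun l hl => ?_
    have := h l hl
    simp only [Pi.add_apply, Nat.add_eq_zero_iff] at this
    exact this.1

theorem multiD_expSum (i : Fin n) {γ : Fin n → ℕ} (hγ : γ ≠ 0) :
    multiD γ (fun y => expSum y i) 0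
      = multiD γ (fun y : Fin n → ℝ => Real.exp (psum (i.val + 1) y)) 0 := by
  obtain ⟨k, hk⟩ := Function.ne_iff.1 hγ
  obtain ⟨δ, rfl⟩ := exists_eq_add_single hk
  rw [multiD_add_single (smoothNear_pi.1 smoothNear_expSum i),
    multiD_add_single (smoothNear_exp_psum _)]
  have e : partialD k (fun y : Fin n → ℝ => expSum y i)
      = partialD k (fun y : Fin n → ℝ => Real.exp (psum (i.val + 1) y)) := by
    ext y
    simp [partialD, expSum, fderiv_sub_const]
  rw [e]

/-- The change `logDiff` turns `x^α` into a product of powers of `exp (y_1 + ⋯ + y_i) - 1`, in which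
`y^β` has a positive coefficient by `multiD_prod_pow_pos`. One change of coordinates serves all
pairs. -/
theorem PsumLE.generates {j : Fin n} {α β : Fin n → ℕ} (hα : IsProperAt j α)
    (hβ : ∀ k, j < k → β k = 0) (h : PsumLE α β) : Generates α β := by
  have hNN : ∀ i : Fin n, NonnegDerivs (fun y : Fin n → ℝ => expSum y i) := fun i =>
    ⟨smoothNear_pi.1 smoothNear_expSum i, fun δ => by
      by_cases hδ : δ = 0
      · subst hδ; rw [multiD_zero]; simp [expSum, psum]
      · rw [multiD_expSum i hδ]; exact (nonnegDerivs_exp_psum _).nonneg δ⟩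
  have hpos := multiD_prod_pow_pos hNN (fun i γ hγ hs => by
    rw [multiD_expSum i hγ]
    exact multiD_exp_psum_pos _ fun k hk => hs k (Nat.lt_of_succ_le hk)) hα hβ h
  have hm := multiD_monomial_pos β
  have hs1 : SmoothNear (fun y : Fin n → ℝ => monomial α (expSum y)) :=
    smoothNear_monomial_comp α smoothNear_expSum
  have hs2 : SmoothNear (monomial β) :=
    smoothNear_monomial_comp β (SmoothNear.of_contDiff contDiff_id)
  -- Dividing by `∂^β y^β = β!` gives the Taylor coefficient of `y^β`, so that the remainder has
  -- none.
  set c := multiD β (fun y => monomial α (expSum y)) 0 / multiD β (monomial β) 0 with hc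
  refine ⟨logDiff, isLowerTriangularCoordChange_logDiff, c,
    fun y => monomial α (expSum y) + (-c) * monomial β y, ?_,
    hs1.add ((smoothNear_const _).mul hs2), ?_, ?_⟩
  · exact (div_pos hpos hm).ne'
  · rw [multiD_add β hs1 ((smoothNear_const _).mul hs2), multiD_const_mul β _ hs2, hc]
    field_simp
    ring
  · filter_upwards [expSum_logDiff] with x hx
    rw [hx]
    ring

/-- The inverse of a triangular change is again triangular. This is recorded only through vanishing
partial derivatives, which is all that the two obstructions to generation below require. -/
theorem Generates.exists_inverse {α β : Fin n → ℕ} (h : Generates α β) :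
    ∃ S : (Fin n → ℝ) → (Fin n → ℝ), SmoothNear S ∧ S 0 = 0 ∧
      (∀ i l : Fin n, i < l → partialD l (fun y => S y i) =ᶠ[𝓝 0] fun _ => 0) ∧
      multiD β (fun y => monomial α (S y)) 0 ≠ 0 := by
  obtain ⟨U, ⟨⟨hU, hU0, S, hS, hS0, hSU, hUS⟩, hdep⟩, c, h, hc, hh, hβ, heq⟩ := h
  have hcomp : ∀ i l : Fin n, ∀ᶠ y in 𝓝 (0 : Fin n → ℝ),
      (if l = i then (1 : ℝ) else 0)
        = ∑ m, partialD l (fun y => S y m) y * partialD m (fun x => U x i) (S y) := by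
    intro i l
    have h1 : (fun y => U (S y) i) =ᶠ[𝓝 0] fun y => y i := by
      filter_upwards [hUS] with y hy
      rw [hy]
    filter_upwards [partialD_comp l (smoothNear_pi.1 hU i) hS hS0, partialD_congr l h1] with y a b
    rw [← a, b, partialD_coord]
  have hUtri : ∀ i m : Fin n, i < m → ∀ᶠ y in 𝓝 (0 : Fin n → ℝ),
      partialD m (fun x => U x i) (S y) = 0 := fun i m him =>
    (tendsto_of_smoothNear hS hS0).eventually (partialD_of_dependsOnFirst (hdep i) him)
  have htri : ∀ N : ℕ, ∀ i : Fin n, i.val = N → ∀ l : Fin n, i < l →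
      partialD l (fun y => S y i) =ᶠ[𝓝 0] fun _ => 0 := by
    intro N
    induction N using Nat.strong_induction_on with
    | _ N ih =>
      intro i hi l hil
      have hlow : ∀ᶠ y in 𝓝 (0 : Fin n → ℝ), ∀ m k : Fin n, m < i → m < k →
          partialD k (fun y => S y m) y = 0 := by
        refine eventually_all.2 fun m => eventually_all.2 fun k => ?_
        by_cases hm : m < i ∧ m < k
        · filter_upwards [ih m.val (hi ▸ hm.1) m rfl k hm.2] with y hy _ _ using hy
        · exact Eventually.of_forall fun y h1 h2 => absurd ⟨h1, h2⟩ hm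
      have hup : ∀ᶠ y in 𝓝 (0 : Fin n → ℝ), ∀ m : Fin n, i < m →
          partialD m (fun x => U x i) (S y) = 0 := by
        refine eventually_all.2 fun m => ?_
        by_cases hm : i < m
        · filter_upwards [hUtri i m hm] with y hy _ using hy
        · exact Eventually.of_forall fun y h1 => absurd h1 hm
      -- In the derivative of `U_i (S y) = y_i` only the term `m = i` survives: `S m` is triangular
      -- by induction for `m < i`, and `U_i` does not involve the variables beyond `i`. The
      -- direction `i` shows that the diagonal derivative of `U` is nonzero; the direction `l` then
      -- gives the claim.
      filter_upwards [hlow, hup, hcomp i l, hcomp i i] with y hl hu c1 c2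
      rw [Finset.sum_eq_single i] at c1 c2
      · simp only [if_true] at c2
        rw [if_neg (ne_of_gt hil)] at c1
        rcases mul_eq_zero.1 c1.symm with h0 | h0
        · exact h0
        · rw [h0] at c2; simp at c2
      all_goals first | (intro h; exact absurd (Finset.mem_univ _) h) | skip
      all_goals
        intro m _ hm
        rcases lt_or_gt_of_ne hm with h1 | h1
        · first
            | rw [hl m i h1 h1, zero_mul]
            | rw [hl m l h1 (h1.trans hil), zero_mul]
        · rw [hu m h1, mul_zero]
  refine ⟨S, hS, hS0, fun i l => htri i.val i rfl l, ?_⟩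
  have hs2 : SmoothNear (monomial β) :=
    smoothNear_monomial_comp β (SmoothNear.of_contDiff contDiff_id)
  have e : (fun y => monomial α (S y)) =ᶠ[𝓝 0] fun y => c * monomial β y + h y := by
    filter_upwards [(tendsto_of_smoothNear hS hS0).eventually heq, hUS] with y h1 h2
    rw [h1, h2]
  rw [multiD_congr_zero β e, multiD_add β ((smoothNear_const c).mul hs2) hh,
    multiD_const_mul β c hs2, hβ, add_zero]
  exact mul_ne_zero hc (multiD_monomial_pos β).ne'

/-- For `i < k` the function `S i` involves only the first `k` variables and vanishes at the origin,
hence has order at least one in them. So `S^α` has order at least `psum k α`, and `y^β` cannot occur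
if its partial sum is smaller. -/
theorem Generates.psumLE {α β : Fin n → ℕ} (h : Generates α β) : PsumLE α β := by
  obtain ⟨S, hS, hS0, htri, hne⟩ := h.exists_inverse
  intro k
  by_contra! hlt
  refine hne ?_
  have hv : ∀ i : Fin n, VanishesTo k (if i.val < k then 1 else 0) (fun y => S y i) := by
    intro i γ hγ
    split_ifs at hγ with hi
    · by_cases hγ0 : γ = 0
      · subst hγ0; rw [multiD_zero]; simp [hS0]
      · obtain ⟨l, hl⟩ := Function.ne_iff.1 hγ0
        have hil : i < l := by
          by_contra hc
          have h1 := le_psum γ (l := l) (k := k) (by rw [Fin.lt_def] at hc; omega)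
          exact hl (by simp; omega)
        exact multiD_eq_zero_of_partialD (smoothNear_pi.1 hS i) (htri i l hil) hl
    · omega
  have := VanishesTo.prod Finset.univ (fun i => (smoothNear_pi.1 hS i).pow (α i))
    (fun i => (hv i).pow (smoothNear_pi.1 hS i) (α i)) β
  have e : ∑ i : Fin n, (if i.val < k then 1 else 0) * α i = psum k α :=
    Finset.sum_congr rfl fun i _ => by split_ifs <;> simp
  exact this (by rwa [e])

/-- If `α j = 0`, then `S^α` involves only components before the `j`-th, none of which depends on
`y_j`, whereas `y^β` does. -/
theorem Generates.one_le {j : Fin n} {α β : Fin n → ℕ} (h : Generates α β) (hβ : IsProperAt j β)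
    (hα : ∀ k, j < k → α k = 0) : 1 ≤ α j := by
  obtain ⟨S, hS, hS0, htri, hne⟩ := h.exists_inverse
  by_contra hc
  have hαj : α j = 0 := by omega
  refine hne (multiD_eq_zero_of_partialD (smoothNear_monomial_comp α hS) (k := j) ?_
    (Nat.one_le_iff_ne_zero.1 hβ.1))
  have hprod : ∀ s : Finset (Fin n),
      partialD j (fun y => ∏ i ∈ s, S y i ^ α i) =ᶠ[𝓝 0] fun _ => 0 := by
    have hpow : ∀ i, partialD j (fun y => S y i ^ α i) =ᶠ[𝓝 0] fun _ => 0 := by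
      intro i
      by_cases hi : i < j
      · have : ∀ m : ℕ, partialD j (fun y => S y i ^ m) =ᶠ[𝓝 0] fun _ => 0 := by
          intro m
          induction m with
          | zero => simp [partialD_const]
          | succ m ih =>
            simp only [pow_succ]
            filter_upwards [partialD_mul j ((smoothNear_pi.1 hS i).pow m) (smoothNear_pi.1 hS i),
              ih, htri i j hi] with y h1 h2 h3
            rw [h1, h2, h3]; ring
        exact this _
      · have : α i = 0 := by
          rcases eq_or_lt_of_le (not_lt.1 hi) with h1 | h1
          · rw [← h1, hαj]
          · exact hα i h1
        simp [this, partialD_const]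
    intro s
    induction s using Finset.induction_on with
    | empty => simp [partialD_const]
    | insert i s hi ih =>
      simp only [Finset.prod_insert hi]
      filter_upwards [partialD_mul j ((smoothNear_pi.1 hS i).pow (α i))
        (SmoothNear.prod s fun i _ => (smoothNear_pi.1 hS i).pow (α i)), ih, hpow i] with y h1 h2 h3
      rw [h1, h2, h3]; ring
  exact hprod _

/-! ### Essential sets through triangular families of functionals -/

theorem multiD_eq_zero_of_dependsOnFirst {p : (Fin n → ℝ) → ℝ} (hp : SmoothNear p) {j : Fin n}
    (hdep : DependsOnFirst (j.val + 1) p) {β : Fin n → ℕ} {k : Fin n} (hjk : j < k)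
    (hk : β k ≠ 0) : multiD β p 0 = 0 :=
  multiD_eq_zero_of_partialD hp (partialD_of_dependsOnFirst hdep hjk) hk

/-- The definition lets arbitrary indices of `p` compete. As `p` ignores the variables beyond `j`,
`Generates.one_le` makes every competitor proper, and between proper multi-indices generation is the
partial sum order. -/
theorem mem_essentialSet_iff {p : (Fin n → ℝ) → ℝ} (hp : SmoothNear p) {j : Fin n}
    (hdep : DependsOnFirst (j.val + 1) p) {α : Fin n → ℕ} :
    α ∈ essentialSet j p ↔ IsProperAt j α ∧ multiD α p 0 ≠ 0 ∧
      ∀ β, IsProperAt j β → multiD β p 0 ≠ 0 → PsumLE β α → β = α := by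
  constructor
  · rintro ⟨h1, h2, h3⟩
    refine ⟨h1, h2, fun β hβ hne hle => ?_⟩
    by_contra hc
    exact h3 β hne ⟨hle.generates hβ h1.2, hc⟩
  · rintro ⟨h1, h2, h3⟩
    refine ⟨h1, h2, fun β hβ hs => hs.2 (h3 β ?_ hβ hs.1.psumLE)⟩
    have hsupp : ∀ k, j < k → β k = 0 := fun k hk => by
      by_contra hc
      exact hβ (multiD_eq_zero_of_dependsOnFirst hp hdep hk hc)
    exact ⟨hs.1.one_le h1 hsupp, hsupp⟩

/-- If membership in `J` of a proper multi-index `α` amounts to `∂^α p (0) ≠ 0` as soon as all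
derivatives of `p` at smaller proper multi-indices vanish, then the essential set of `p` can be
read off from `J`. -/
theorem essentialSet_eq_iff {p : (Fin n → ℝ) → ℝ} (hp : SmoothNear p) {j : Fin n}
    (hdep : DependsOnFirst (j.val + 1) p) {E J : Set (Fin n → ℕ)}
    (hJ : ∀ α, IsProperAt j α →
      (∀ β, IsProperAt j β → PsumLE β α → β ≠ α → multiD β p 0 = 0) →
        (α ∈ J ↔ multiD α p 0 ≠ 0))
    (hE : ∀ ε ∈ E, IsProperAt j ε) (hE' : ∀ ε ∈ E, ∀ ε' ∈ E, ¬ StrictlyGenerates ε ε') :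
    essentialSet j p = E ↔
      (∀ ε ∈ E, ε ∈ J) ∧ ∀ ζ, IsProperAt j ζ → (∀ ε ∈ E, ¬ Generates ε ζ) → ζ ∉ J := by
  constructor
  · rintro rfl
    constructor
    · intro ε hε
      obtain ⟨h1, h2, h3⟩ := (mem_essentialSet_iff hp hdep).1 hε
      refine (hJ ε h1 fun β hβ hle hne => ?_).2 h2
      by_contra hc
      exact hne (h3 β hβ hc hle)
    · intro ζ hζ hgen hmem
      -- A nonzero derivative below `ζ` would dominate a minimal one, which is essential and
      -- therefore generates `ζ`.
      have hz : ∀ β, IsProperAt j β → PsumLE β ζ → multiD β p 0 = 0 := by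
        intro β hβ hle
        by_contra hc
        obtain ⟨γ, ⟨hγ, hγ'⟩, hγβ, hmin⟩ :=
          exists_minimal_psumLE (I := {β | IsProperAt j β ∧ multiD β p 0 ≠ 0}) ⟨hβ, hc⟩
        refine hgen γ ((mem_essentialSet_iff hp hdep).2
          ⟨hγ, hγ', fun δ h1 h2 h3 => hmin δ ⟨h1, h2⟩ h3⟩) ?_
        exact (hγβ.trans hle).generates hγ hζ.2
      exact (hJ ζ hζ fun β hβ hle _ => hz β hβ hle).1 hmem (hz ζ hζ (.refl ζ))
  · rintro ⟨hEJ, hJE⟩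
    have anti : ∀ ε ∈ E, ∀ ε' ∈ E, PsumLE ε ε' → ε = ε' := fun ε hε ε' hε' hle => by
      by_contra hc
      exact hE' ε hε ε' hε' ⟨hle.generates (hE ε hε) (hE ε' hε').2, hc⟩
    -- Take a minimal counterexample `γ`. All derivatives strictly below it vanish, so `γ` lies in
    -- `J`, although no element of `E` generates it.
    have hup : ∀ α, IsProperAt j α → multiD α p 0 ≠ 0 → ∃ ε ∈ E, PsumLE ε α := by
      intro α hα hne
      by_contra! hc
      obtain ⟨γ, ⟨hγ, hγ', hγE⟩, -, hmin⟩ := exists_minimal_psumLE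
        (I := {β | IsProperAt j β ∧ multiD β p 0 ≠ 0 ∧ ∀ ε ∈ E, ¬ PsumLE ε β}) ⟨hα, hne, hc⟩
      refine hJE γ hγ (fun ε hε hg => hγE ε hε hg.psumLE) ((hJ γ hγ fun β hβ hle hβγ => ?_).2 hγ')
      by_contra hβ'
      exact hβγ (hmin β ⟨hβ, hβ', fun ε hε h => hγE ε hε (h.trans hle)⟩ hle)
    -- An index of `p` below `ε` dominates some element of `E`, which must be `ε` itself by the
    -- antichain property. Thus nothing lies strictly below `ε` and `J` detects its derivative.
    have hEI : ∀ ε ∈ E, multiD ε p 0 ≠ 0 := by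
      intro ε hε
      refine (hJ ε (hE ε hε) fun β hβ hle hne => ?_).1 (hEJ ε hε)
      by_contra hc
      obtain ⟨ε', hε', hle'⟩ := hup β hβ hc
      obtain rfl := anti ε' hε' ε hε (hle'.trans hle)
      exact hne (hle.antisymm hle')
    ext α
    rw [mem_essentialSet_iff hp hdep]
    constructor
    · rintro ⟨h1, h2, h3⟩
      obtain ⟨ε, hε, hle⟩ := hup α h1 h2
      exact h3 ε (hE ε hε) (hEI ε hε) hle ▸ hε
    · intro hα
      refine ⟨hE α hα, hEI α hα, fun β hβ hne hle => ?_⟩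
      obtain ⟨ε, hε, hle'⟩ := hup β hβ hne
      obtain rfl := anti ε hε α hα (hle'.trans hle)
      exact hle.antisymm hle'

/-! ### First order operators with triangular coefficients -/

/-- A derivative falling on a coefficient `A m` lowers the total degree reaching `p`, and replacing
`∂_k` by a later `∂_m` lowers a partial sum. Either way the derivative of `p` sits strictly below `α
+ e_k` and vanishes, so only the leading term remains. -/
theorem multiD_sum_mul_partialD {A : Fin n → (Fin n → ℝ) → ℝ} {p : (Fin n → ℝ) → ℝ}
    (hA : ∀ m, SmoothNear (A m)) (hp : SmoothNear p) {k : Fin n}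
    (hk : ∀ m < k, A m =ᶠ[𝓝 0] fun _ => 0) {α : Fin n → ℕ}
    (h : ∀ (β : Fin n → ℕ) (m : Fin n), k ≤ m → PsumLE (β + Pi.single m 1) (α + Pi.single k 1) →
      β + Pi.single m 1 ≠ α + Pi.single k 1 → multiD (β + Pi.single m 1) p 0 = 0)
    {β : Fin n → ℕ} (hβ : PsumLE β α) :
    multiD β (fun x => ∑ m, A m x * partialD m p x) 0
      = if β = α then A k 0 * multiD (α + Pi.single k 1) p 0 else 0 := by
  rw [multiD_sum Finset.univ β fun m => (hA m).mul (hp.partialD m)]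
  have hle : ∀ γ ≤ β, ∀ m, k ≤ m →
      PsumLE (γ + Pi.single m 1) (α + Pi.single k 1) := by
    intro γ hγ m hm t
    have h1 := hβ t
    have h2 := psum_mono t hγ
    rw [Fin.le_def] at hm
    rw [psum_add, psum_add, psum_single, psum_single]
    split_ifs <;> omega
  have hterm : ∀ m, k ≤ m → multiD β (fun x => A m x * partialD m p x) 0
      = A m 0 * multiD (β + Pi.single m 1) p 0 := by
    intro m hm
    rw [multiD_mul_of_vanishing (hA m) (hp.partialD m), multiD_add_single hp]
    intro γ hγ hne
    rw [← multiD_add_single hp]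
    refine h γ m hm (hle γ hγ m hm) fun e => ?_
    have h1 := congrArg (psum n) e
    rw [psum_add, psum_add, psum_single, psum_single] at h1
    have h2 := sum_lt_sum_of_le_of_ne hγ hne
    have h3 := hβ n
    simp only [Fin.is_lt, if_true] at h1
    omega
  rw [Finset.sum_eq_single k]
  · rw [hterm k le_rfl]
    split_ifs with e
    · rw [e]
    · rw [h β k le_rfl (hle β le_rfl k le_rfl) (by simpa using e), mul_zero]
  · intro m _ hm
    rcases lt_or_gt_of_ne hm with h1 | h1
    · have : (fun x => A m x * partialD m p x) =ᶠ[𝓝 0] fun _ => 0 := by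
        filter_upwards [hk m h1] with x hx
        rw [hx, zero_mul]
      rw [multiD_congr_zero β this, multiD_fun_zero]
    · rw [hterm m h1.le, h β m h1.le (hle β le_rfl m h1.le), mul_zero]
      intro e
      -- The partial sum ending at `k` counts `e_k` but not `e_m`, which separates the two
      -- multi-indices.
      have h2 := congrArg (psum (k.val + 1)) e
      rw [psum_add, psum_add, psum_single, psum_single] at h2
      have h3 := hβ (k.val + 1)
      rw [Fin.lt_def] at h1
      rw [if_neg (by omega), if_pos (by omega)] at h2
      omega
  · simp

/-! ### Lie brackets in coordinates -/

theorem lieBracket_apply {V W : (Fin n → ℝ) → (Fin n → ℝ)} (hV : SmoothNear V)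
    (hW : SmoothNear W) (m : Fin n) :
    (fun x => VectorField.lieBracket ℝ V W x m) =ᶠ[𝓝 0] fun x =>
      (∑ l, V x l * partialD l (fun y => W y m) x) - ∑ l, W x l * partialD l (fun y => V y m) x := by
  filter_upwards [hV.differentiable, hW.differentiable] with x h1 h2
  have e : ∀ {Z : (Fin n → ℝ) → (Fin n → ℝ)} (v : Fin n → ℝ), DifferentiableAt ℝ Z x →
      fderiv ℝ Z x v m = ∑ l, v l * partialD l (fun y => Z y m) x := by
    intro Z v hZ
    rw [← fderiv_apply_eq_sum]
    have h4 : fderiv ℝ (fun y => Z y m) x = (ContinuousLinearMap.proj m).comp (fderiv ℝ Z x) :=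
      fderiv_apply hZ m
    simp [h4]
  rw [VectorField.lieBracket, Pi.sub_apply, e _ h2, e _ h1]

theorem SmoothNear.lieBracket {V W : (Fin n → ℝ) → (Fin n → ℝ)} (hV : SmoothNear V)
    (hW : SmoothNear W) : SmoothNear (VectorField.lieBracket ℝ V W) :=
  (hW.fderiv_apply hV).sub (hV.fderiv_apply hW)

/-- The subspace of vectors whose first `l` entries vanish. -/
def coordFlag (n l : ℕ) : Submodule ℝ (Fin n → ℝ) where
  carrier := {w | ∀ m : Fin n, m.val < l → w m = 0}
  add_mem' := fun ha hb m hm => by simp [ha m hm, hb m hm]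
  zero_mem' := fun _ _ => rfl
  smul_mem' := fun c a ha m hm => by simp [ha m hm]

theorem mem_coordFlag {l : ℕ} {w : Fin n → ℝ} :
    w ∈ coordFlag n l ↔ ∀ m : Fin n, m.val < l → w m = 0 := Iff.rfl

/-- Since `f_m` involves no variable beyond `x_{m+1}`, bracketing with `f` moves a field down the
coordinate flag by at most one step. -/
theorem lieBracket_eventuallyEq_zero {f : (Fin n → ℝ) → (Fin n → ℝ)} (hf : SmoothNear f)
    (hdep : ∀ i : Fin n, DependsOnFirst (i.val + 2) (fun x => f x i))
    {V : (Fin n → ℝ) → (Fin n → ℝ)} (hV : SmoothNear V) {j : ℕ}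
    (hVj : ∀ᶠ x in 𝓝 (0 : Fin n → ℝ), V x ∈ coordFlag n j) {m : Fin n} (hm : m.val + 1 < j) :
    (fun x => VectorField.lieBracket ℝ V f x m) =ᶠ[𝓝 0] fun _ => 0 := by
  have h0 : ∀ᶠ x in 𝓝 (0 : Fin n → ℝ), ∀ l, partialD l (fun y => V y m) x = 0 := by
    refine eventually_all.2 fun l => partialD_congr_zero l ?_
    filter_upwards [hVj] with x hx using hx m (by omega)
  have h1 : ∀ᶠ x in 𝓝 (0 : Fin n → ℝ), ∀ l, V x l * partialD l (fun y => f y m) x = 0 := by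
    refine eventually_all.2 fun l => ?_
    by_cases hl : l.val < j
    · filter_upwards [hVj] with x hx
      rw [hx l hl, zero_mul]
    · filter_upwards [partialD_of_dependsOnFirst (hdep m) (j := l) (by omega)] with x hx
      rw [hx, mul_zero]
  filter_upwards [lieBracket_apply hV hf m, h0, h1] with x h2 h3 h4
  rw [h2]
  simp [h3, h4]

/-! ### The leading term of iterated brackets -/

/-- A tuple of vector fields `Y k`, where `Y k` has vanishing components before the `k`-th one,
a nonzero `k`-th component, and an `m`-th component that depends on the first `m` coordinates. -/
structure IsTriangularTuple (Y : Fin n → (Fin n → ℝ) → (Fin n → ℝ)) : Prop where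
  smooth : ∀ k, SmoothNear (Y k)
  lower : ∀ k m, m < k → (fun x => Y k x m) =ᶠ[𝓝 0] fun _ => 0
  indep : ∀ k m l, m < l → partialD l (fun x => Y k x m) =ᶠ[𝓝 0] fun _ => 0
  ne : ∀ k, Y k 0 k ≠ 0

/-- The `i`-th component of `W` is obtained from `p` by an operator with leading part of
multi-index `α`, and the components before the `i`-th one vanish. -/
structure IsLeading (i j : Fin n) (p : (Fin n → ℝ) → ℝ) (α : Fin n → ℕ)
    (W : (Fin n → ℝ) → (Fin n → ℝ)) : Prop where
  smooth : SmoothNear W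
  lower : ∀ m < i, (fun x => W x m) =ᶠ[𝓝 0] fun _ => 0
  lead : ∀ δ : Fin n → ℕ,
    (∀ β, IsProperAt j β → PsumLE β (δ + α) → β ≠ δ + α → multiD β p 0 = 0) →
      (∀ β, PsumLE β δ → β ≠ δ → multiD β (fun x => W x i) 0 = 0) ∧
        (multiD δ (fun x => W x i) 0 ≠ 0 ↔ multiD (δ + α) p 0 ≠ 0)

/-- The innermost bracket must be with `Y j`: the components of `Y j` before the `j`-th vanish, so
`[Y j, f]_i` is just the derivative of `f_i` along `Y j`, and the components before `i = j - 1`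
vanish altogether. Later brackets rely on this vanishing, which `f` itself lacks. -/
theorem IsLeading.base {f : (Fin n → ℝ) → (Fin n → ℝ)} (hf : SmoothNear f)
    (hdep : ∀ i : Fin n, DependsOnFirst (i.val + 2) (fun x => f x i))
    {Y : Fin n → (Fin n → ℝ) → (Fin n → ℝ)} (hY : IsTriangularTuple Y) {i j : Fin n}
    (hij : i.val + 1 = j.val) :
    IsLeading i j (fun x => f x i) (Pi.single j 1) (VectorField.lieBracket ℝ (Y j) f) := by
  have hYs := fun k => smoothNear_pi.1 (hY.smooth k)
  have hfs := smoothNear_pi.1 hf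
  have hcomp : ∀ m < j, (fun x => VectorField.lieBracket ℝ (Y j) f x m) =ᶠ[𝓝 0] fun x =>
      ∑ l, Y j x l * partialD l (fun y => f y m) x := by
    intro m hm
    have h0 : ∀ᶠ x in 𝓝 (0 : Fin n → ℝ), ∀ l, partialD l (fun y => Y j y m) x = 0 :=
      eventually_all.2 fun l => partialD_congr_zero l (hY.lower j m hm)
    filter_upwards [lieBracket_apply (hY.smooth j) hf m, h0] with x h1 h2
    rw [h1]
    simp [h2]
  refine ⟨(hY.smooth j).lieBracket hf, fun m hm => ?_, fun δ hδ => ?_⟩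
  · refine lieBracket_eventuallyEq_zero hf hdep (hY.smooth j) (j := j.val) ?_
      (by rw [Fin.lt_def] at hm; omega)
    exact eventually_all.2 fun l => by
      by_cases hl : l < j
      · filter_upwards [hY.lower j l hl] with x hx _ using hx
      · exact Eventually.of_forall fun x h => absurd h hl
  · have hij' : i < j := by rw [Fin.lt_def]; omega
    have hdep' : DependsOnFirst (j.val + 1) (fun x => f x i) := by
      have := hdep i
      rwa [show i.val + 2 = j.val + 1 by omega] at this
    have key : ∀ β, PsumLE β δ → multiD β (fun x => VectorField.lieBracket ℝ (Y j) f x i) 0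
        = if β = δ then Y j 0 j * multiD (δ + Pi.single j 1) (fun x => f x i) 0 else 0 := by
      intro β hβ
      rw [multiD_congr_zero β (hcomp i hij')]
      refine multiD_sum_mul_partialD (hYs j) (hfs i) (hY.lower j) (fun γ m hm hle hne => ?_) hβ
      -- Multi-indices reaching beyond `j` kill `f_i`, which ignores these variables; the others are
      -- proper because `m ≥ j` forces `m = j`.
      by_cases hs : ∃ l, j < l ∧ (γ + Pi.single m 1 : Fin n → ℕ) l ≠ 0
      · obtain ⟨l, hl, hl'⟩ := hs
        exact multiD_eq_zero_of_dependsOnFirst (hfs i) hdep' hl hl'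
      · push Not at hs
        have hmj : m = j := by
          by_contra hc
          have := hs m (lt_of_le_of_ne hm (Ne.symm hc))
          simp at this
        subst hmj
        exact hδ _ ⟨by simp, hs⟩ hle hne
    refine ⟨fun β hβ hne => by rw [key β hβ, if_neg hne], ?_⟩
    rw [key δ (.refl δ), if_pos rfl]
    simp [hY.ne j]

/-- As `W` starts at component `i` and `(Y k)_i` involves no later variable, `[Y k, W]_i` is the
derivative of `W_i` along `Y k` plus a multiple of `W_i`. The latter has lower order and drops out.
Quantifying over `δ` in `lead` is what makes the induction work: the step uses the hypothesis at `δ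
+ e_k`. -/
theorem IsLeading.step {i j : Fin n} {p : (Fin n → ℝ) → ℝ} {α : Fin n → ℕ}
    {W : (Fin n → ℝ) → (Fin n → ℝ)} (hW : IsLeading i j p α W)
    {Y : Fin n → (Fin n → ℝ) → (Fin n → ℝ)} (hY : IsTriangularTuple Y) (k : Fin n) :
    IsLeading i j p (α + Pi.single k 1) (VectorField.lieBracket ℝ (Y k) W) := by
  have hYs := smoothNear_pi.1 (hY.smooth k)
  have hWs := smoothNear_pi.1 hW.smooth
  have hY0 : ∀ m l, m ≤ i → l ≠ i ∨ m ≠ i →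
      ∀ᶠ x in 𝓝 (0 : Fin n → ℝ), W x l * partialD l (fun y => Y k y m) x = 0 := by
    intro m l hm hl
    rcases lt_or_ge l i with h | h
    · filter_upwards [hW.lower l h] with x hx
      rw [hx, zero_mul]
    · have hml : m < l := lt_of_le_of_ne (hm.trans h) fun e => by
        subst e
        have := le_antisymm hm h
        simp [this] at hl
      filter_upwards [hY.indep k m l hml] with x hx
      rw [hx, mul_zero]
  refine ⟨(hY.smooth k).lieBracket hW.smooth, fun m hm => ?_, fun δ hδ => ?_⟩
  · have h1 : ∀ᶠ x in 𝓝 (0 : Fin n → ℝ), ∀ l, W x l * partialD l (fun y => Y k y m) x = 0 :=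
      eventually_all.2 fun l => hY0 m l hm.le (.inr hm.ne)
    have h2 : ∀ᶠ x in 𝓝 (0 : Fin n → ℝ), ∀ l, partialD l (fun y => W y m) x = 0 :=
      eventually_all.2 fun l => partialD_congr_zero l (hW.lower m hm)
    filter_upwards [lieBracket_apply (hY.smooth k) hW.smooth m, h1, h2] with x h3 h4 h5
    rw [h3]
    simp [h4, h5]
  · have hcomp : (fun x => VectorField.lieBracket ℝ (Y k) W x i) =ᶠ[𝓝 0] fun x =>
        (∑ l, Y k x l * partialD l (fun y => W y i) x)
          + ((-1) * partialD i (fun y => Y k y i) x) * W x i := by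
      have h1 : ∀ᶠ x in 𝓝 (0 : Fin n → ℝ), ∀ l, l ≠ i →
          W x l * partialD l (fun y => Y k y i) x = 0 := by
        refine eventually_all.2 fun l => ?_
        by_cases hl : l = i
        · exact Eventually.of_forall fun x h => absurd hl h
        · filter_upwards [hY0 i l le_rfl (.inl hl)] with x hx _ using hx
      filter_upwards [lieBracket_apply (hY.smooth k) hW.smooth i, h1] with x h3 h4
      rw [h3, Finset.sum_eq_single i (f := fun l => W x l * partialD l (fun y => Y k y i) x)
        (fun l _ hl => h4 l hl) (by simp)]
      ring
    have e : δ + (α + Pi.single k 1) = (δ + Pi.single k 1) + α := by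
      rw [add_comm α, add_assoc]
    rw [e] at hδ ⊢
    obtain ⟨h1, h2⟩ := hW.lead (δ + Pi.single k 1) hδ
    have hB : SmoothNear (fun x => (-1) * partialD i (fun y => Y k y i) x) :=
      (smoothNear_const _).mul ((hYs i).partialD i)
    have hz : ∀ β, PsumLE β δ → multiD β (fun x => W x i) 0 = 0 := by
      intro β hβ
      refine h1 β (hβ.trans (psumLE_of_le fun l => by simp)) fun h => ?_
      have h3 := hβ n
      rw [h, psum_add, psum_single] at h3
      simp at h3
    have key : ∀ β, PsumLE β δ → multiD β (fun x => VectorField.lieBracket ℝ (Y k) W x i) 0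
        = if β = δ then Y k 0 k * multiD (δ + Pi.single k 1) (fun x => W x i) 0 else 0 := by
      intro β hβ
      rw [multiD_congr_zero β hcomp, multiD_add β
        (SmoothNear.sum _ fun l _ => (hYs l).mul ((hWs i).partialD l)) (hB.mul (hWs i)),
        multiD_sum_mul_partialD hYs (hWs i) (hY.lower k) (fun γ m _ => h1 _) hβ,
        multiD_mul_of_vanishing hB (hWs i) β fun γ hγ _ => hz γ ((psumLE_of_le hγ).trans hβ),
        hz β hβ, mul_zero, add_zero]
    refine ⟨fun β hβ hne => by rw [key β hβ, if_neg hne], ?_⟩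
    rw [key δ (.refl δ), if_pos rfl, ← h2]
    simp [hY.ne k]

theorem IsLeading.iterate {i j : Fin n} {p : (Fin n → ℝ) → ℝ} {α : Fin n → ℕ}
    {W : (Fin n → ℝ) → (Fin n → ℝ)} (hW : IsLeading i j p α W)
    {Y : Fin n → (Fin n → ℝ) → (Fin n → ℝ)} (hY : IsTriangularTuple Y) (k : Fin n) (m : ℕ) :
    IsLeading i j p (α + Pi.single k m) ((VectorField.lieBracket ℝ (Y k))^[m] W) := by
  induction m with
  | zero => simpa using hW
  | succ m ih =>
    rw [Function.iterate_succ_apply', Pi.single_add, ← add_assoc]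
    exact ih.step hY k

theorem IsLeading.foldr {i j : Fin n} {p : (Fin n → ℝ) → ℝ} {α : Fin n → ℕ}
    {W : (Fin n → ℝ) → (Fin n → ℝ)} (hW : IsLeading i j p α W)
    {Y : Fin n → (Fin n → ℝ) → (Fin n → ℝ)} (hY : IsTriangularTuple Y) (β : Fin n → ℕ)
    (l : List (Fin n)) :
    IsLeading i j p (α + (l.map fun k => (Pi.single k (β k) : Fin n → ℕ)).sum)
      (l.foldr (fun k W => (VectorField.lieBracket ℝ (Y k))^[β k] W) W) := by
  induction l with
  | nil => simpa using hW
  | cons a l ih =>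
    simp only [List.map_cons, List.sum_cons, List.foldr_cons]
    rw [add_comm (Pi.single a (β a) : Fin n → ℕ), ← add_assoc]
    exact ih.iterate hY a (β a)

theorem isLeading_adMulti {f : (Fin n → ℝ) → (Fin n → ℝ)} (hf : SmoothNear f)
    (hdep : ∀ i : Fin n, DependsOnFirst (i.val + 2) (fun x => f x i))
    {Y : Fin n → (Fin n → ℝ) → (Fin n → ℝ)} (hY : IsTriangularTuple Y) {i j : Fin n}
    (hij : i.val + 1 = j.val) {α : Fin n → ℕ} (hα : IsProperAt j α) :
    IsLeading i j (fun x => f x i) α (adMulti Y α f) := by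
  -- Entries after `j` have exponent zero, so the first bracket to act is one with `Y j`; it is
  -- handled by `IsLeading.base` and all others by `IsLeading.step`.
  obtain ⟨s, t, hst⟩ := List.append_of_mem (List.mem_finRange j)
  have hsort := List.pairwise_lt_finRange n
  have hsum : ((List.finRange n).map fun k => (Pi.single k (α k) : Fin n → ℕ)).sum = α := by
    rw [← Fin.sum_univ_def]
    exact Finset.univ_sum_single α
  have hge : ∀ k ∈ t, α k = 0 := by
    rw [hst, List.pairwise_append] at hsort
    exact fun k hk => hα.2 k (List.rel_of_pairwise_cons hsort.2.1 hk)
  have htf : t.foldr (fun k W => (VectorField.lieBracket ℝ (Y k))^[α k] W) f = f := by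
    clear hst
    induction t with
    | nil => rfl
    | cons a t ih =>
      rw [List.foldr_cons, ih fun k hk => hge k (List.mem_cons_of_mem _ hk), hge a (by simp)]
      rfl
  have hts : (t.map fun k => (Pi.single k (α k) : Fin n → ℕ)).sum = 0 := by
    refine List.sum_eq_zero fun v hv => ?_
    obtain ⟨k, hk, rfl⟩ := List.mem_map.1 hv
    rw [hge k hk, Pi.single_zero]
  obtain ⟨a, ha⟩ : ∃ a, α j = a + 1 := ⟨α j - 1, by have := hα.1; omega⟩
  have h := (((IsLeading.base hf hdep hY hij).iterate hY j a).foldr hY α s)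
  rw [← Pi.single_add, add_comm 1 a, ← ha] at h
  have e1 : Pi.single j (α j) + (s.map fun k => (Pi.single k (α k) : Fin n → ℕ)).sum = α := by
    conv_rhs => rw [← hsum, hst]
    rw [List.map_append, List.sum_append, List.map_cons, List.sum_cons, hts, add_zero, add_comm]
  have e2 : adMulti Y α f = s.foldr (fun k W => (VectorField.lieBracket ℝ (Y k))^[α k] W)
      ((VectorField.lieBracket ℝ (Y j))^[a] (VectorField.lieBracket ℝ (Y j) f)) := by
    rw [adMulti, hst, List.foldr_append, List.foldr_cons, htf, ha, Function.iterate_succ_apply]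
  rw [e1] at h
  rw [e2]
  exact h

theorem hasType_iff_bracketCondition {f : (Fin n → ℝ) → (Fin n → ℝ)} (hf : SmoothNear f)
    (hdep : ∀ i : Fin n, DependsOnFirst (i.val + 2) (fun x => f x i))
    {Y : Fin n → (Fin n → ℝ) → (Fin n → ℝ)} (hY : IsTriangularTuple Y)
    {D : ℕ → (Fin n → ℝ) → Submodule ℝ (Fin n → ℝ)}
    (hD : ∀ l < n, D l 0 = coordFlag n l) {E : Fin n → Set (Fin n → ℕ)} (hE : IsTypeData E) :
    HasType f E ↔ BracketCondition f D Y E := by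
  refine forall_congr' fun i => forall_congr' fun j => forall_congr' fun hij => ?_
  have hdep' : DependsOnFirst (j.val + 1) (fun x => f x i) := by
    have := hdep i
    rwa [show i.val + 2 = j.val + 1 by omega] at this
  -- The components before the `i`-th vanish anyway, so membership in the flag is decided by the
  -- `i`-th one.
  have hmem : ∀ α, IsProperAt j α →
      (adMulti Y α f 0 ∈ D (i.val + 1) 0 ↔ adMulti Y α f 0 i = 0) := by
    intro α hα
    rw [hD _ (hij ▸ j.isLt), mem_coordFlag]
    refine ⟨fun h => h i (Nat.lt_succ_self _), fun h m hm => ?_⟩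
    rcases eq_or_lt_of_le (show m ≤ i from Nat.lt_succ_iff.1 hm) with e | e
    · rw [e, h]
    · exact ((isLeading_adMulti hf hdep hY hij hα).lower m e).self_of_nhds
  rw [essentialSet_eq_iff (smoothNear_pi.1 hf i) hdep'
    (J := {α | adMulti Y α f 0 i ≠ 0}) ?_ (hE i j hij).1 (hE i j hij).2]
  · refine and_congr (forall₂_congr fun ε hε => ?_) (forall_congr' fun ζ => forall₂_congr
      fun hζ _ => ?_)
    · rw [hmem ε ((hE i j hij).1 ε hε)]; rfl
    · rw [hmem ζ hζ]; simp
  · intro α hα h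
    have := ((isLeading_adMulti hf hdep hY hij hα).lead 0 (by simpa using h)).2
    rwa [multiD_zero, zero_add] at this

/-! ### Coordinate flags -/

theorem coordFlag_anti {l k : ℕ} (h : l ≤ k) : coordFlag n k ≤ coordFlag n l :=
  fun _ hw m hm => hw m (hm.trans_le h)

theorem single_mem_coordFlag {l : ℕ} {k : Fin n} (h : l ≤ k.val) :
    (Pi.single k 1 : Fin n → ℝ) ∈ coordFlag n l := by
  intro m hm
  have : m ≠ k := by rintro rfl; omega
  simp [this]

theorem single_notMem_coordFlag (k : Fin n) :
    (Pi.single k 1 : Fin n → ℝ) ∉ coordFlag n (k.val + 1) := fun h => by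
  simpa using h k (Nat.lt_succ_self _)

theorem coordFlag_self : coordFlag n n = ⊥ := by
  rw [eq_bot_iff]
  intro w hw
  exact (Submodule.mem_bot ℝ).2 (funext fun m => hw m m.isLt)

/-- Gaussian elimination with vectors in echelon form, removing the leading entry of `w` first. -/
theorem coordFlag_le_of_mem {P : Submodule ℝ (Fin n → ℝ)} {l : ℕ}
    (h : ∀ k : Fin n, l ≤ k.val → ∃ v ∈ P, v ∈ coordFlag n k.val ∧ v k ≠ 0) :
    coordFlag n l ≤ P := by
  induction hd : n - l generalizing l with
  | zero =>
    intro w hw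
    have : w = 0 := funext fun m => hw m (by omega)
    exact this ▸ P.zero_mem
  | succ d ih =>
    intro w hw
    obtain ⟨v, hvP, hv, hne⟩ := h ⟨l, by omega⟩ le_rfl
    set c := w ⟨l, by omega⟩ / v ⟨l, by omega⟩ with hc
    have h1 : w - c • v ∈ coordFlag n (l + 1) := by
      intro m hm
      rcases Nat.lt_succ_iff_lt_or_eq.1 hm with h2 | h2
      · simp [hw m h2, hv m h2]
      · have : m = ⟨l, by omega⟩ := Fin.ext h2
        rw [this, hc]
        simp [hne]
    have h3 := ih (l := l + 1) (fun k hk => h k (by omega)) (by omega) h1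
    simpa using P.add_mem h3 (P.smul_mem c hvP)

/-- The standard frame of `coordFlag n l`. -/
def stdFrame (n l : ℕ) (i : Fin (n - l)) : Fin n → ℝ := Pi.single ⟨l + i.val, by omega⟩ 1

theorem linearIndependent_stdFrame (l : ℕ) : LinearIndependent ℝ (stdFrame n l) := by
  have h := (Pi.basisFun ℝ (Fin n)).linearIndependent.comp
    (fun i : Fin (n - l) => (⟨l + i.val, by omega⟩ : Fin n)) (fun a b hab => by
      have := congrArg Fin.val hab
      exact Fin.ext (by simpa using this))
  convert h using 1
  ext i
  simp [stdFrame]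

theorem coordFlag_eq_span (l : ℕ) :
    coordFlag n l = Submodule.span ℝ (Set.range (stdFrame n l)) := by
  refine le_antisymm (coordFlag_le_of_mem fun k hk => ⟨Pi.single k 1, Submodule.subset_span ?_,
    single_mem_coordFlag le_rfl, by simp⟩) (Submodule.span_le.2 ?_)
  · exact ⟨⟨k.val - l, by omega⟩, by simp [stdFrame, Nat.add_sub_cancel' hk]⟩
  · rintro _ ⟨i, rfl⟩
    exact single_mem_coordFlag (by simp)

theorem finrank_coordFlag (l : ℕ) : Module.finrank ℝ (coordFlag n l) = n - l := by
  rw [coordFlag_eq_span, finrank_span_eq_card (linearIndependent_stdFrame l), Fintype.card_fin]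

/-! ### Density near the origin -/

theorem closure_mem_nhds_of_eventually {A B : Set (Fin n → ℝ)} (hA : closure A ∈ 𝓝 0)
    (h : ∀ᶠ x in 𝓝 (0 : Fin n → ℝ), x ∈ A → x ∈ B) : closure B ∈ 𝓝 0 := by
  filter_upwards [hA, eventually_eventually_nhds.2 h] with x hx hxy
  rw [mem_closure_iff_frequently] at hx ⊢
  exact (hx.and_eventually hxy).mono fun y hy => hy.2 hy.1

theorem closure_inter_mem_nhds {A B : Set (Fin n → ℝ)} (hAo : IsOpen A) (hA : closure A ∈ 𝓝 0)
    (hB : closure B ∈ 𝓝 0) : closure (A ∩ B) ∈ 𝓝 0 := by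
  have h := closure_mem_nhds_of_eventually (B := closure (A ∩ B)) hA (by
    filter_upwards [hB] with x hx hxA using hAo.inter_closure ⟨hxA, hx⟩)
  rwa [closure_closure] at h

theorem closure_iInter_mem_nhds {ι : Type*} (s : Finset ι) {A : ι → Set (Fin n → ℝ)}
    (hAo : ∀ i, IsOpen (A i)) (hA : ∀ i, closure (A i) ∈ 𝓝 0) :
    closure {x | ∀ i ∈ s, x ∈ A i} ∈ 𝓝 0 := by
  classical
  induction s using Finset.induction_on with
  | empty => simp
  | insert i s hi ih =>
    convert closure_inter_mem_nhds (hAo i) (hA i) ih using 2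
    ext x
    simp

theorem eventuallyEq_zero_of_dense {φ : (Fin n → ℝ) → ℝ} (hφ : SmoothNear φ)
    {O : Set (Fin n → ℝ)} (hO : closure O ∈ 𝓝 0)
    (h : ∀ᶠ x in 𝓝 (0 : Fin n → ℝ), x ∈ O → φ x = 0) : φ =ᶠ[𝓝 0] fun _ => 0 := by
  filter_upwards [hO, eventually_eventually_nhds.2 h, hφ] with x hx hxy hc
  by_contra hne
  rw [mem_closure_iff_frequently] at hx
  obtain ⟨y, hy, hy', hy''⟩ :=
    (hx.and_eventually (hxy.and (hc.continuousAt.eventually_ne hne))).exists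
  exact hy'' (hy' hy)

/-! ### System flags of lower triangular forms -/

theorem IsLowerTriangularForm.eventually_g_mem {f g : (Fin n → ℝ) → (Fin n → ℝ)}
    (hfg : IsLowerTriangularForm f g) :
    ∀ᶠ x in 𝓝 (0 : Fin n → ℝ), g x ∈ coordFlag n (n - 1) := by
  refine eventually_all.2 fun m => ?_
  by_cases hm : m.val + 1 < n
  · filter_upwards [hfg.g_zero m hm] with x hx _ using hx
  · exact Eventually.of_forall fun x h => by omega

theorem IsLowerTriangularForm.eventually_g_ne {f g : (Fin n → ℝ) → (Fin n → ℝ)}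
    (hfg : IsLowerTriangularForm f g) :
    ∀ᶠ x in 𝓝 (0 : Fin n → ℝ), ∀ k : Fin n, k.val + 1 = n → g x k ≠ 0 := by
  refine eventually_all.2 fun k => ?_
  by_cases hk : k.val + 1 = n
  · filter_upwards [(smoothNear_pi.1 hfg.smooth_g k).continuousAt.eventually_ne (hfg.g_ne k hk)]
      with x hx _ using hx
  · exact Eventually.of_forall fun x h => absurd h hk

theorem IsLowerTriangularForm.eventually_span_g {f g : (Fin n → ℝ) → (Fin n → ℝ)}
    (hfg : IsLowerTriangularForm f g) {l : ℕ} (hl : l + 1 = n) :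
    ∀ᶠ x in 𝓝 (0 : Fin n → ℝ), coordFlag n l = Submodule.span ℝ {g x} := by
  have hl' : l = n - 1 := by omega
  filter_upwards [hfg.eventually_g_mem, hfg.eventually_g_ne] with x h1 h2
  refine le_antisymm (coordFlag_le_of_mem fun k hk => ⟨g x, Submodule.mem_span_singleton_self _,
    coordFlag_anti (by omega) h1, h2 k (by omega)⟩) ?_
  rw [Submodule.span_le, Set.singleton_subset_iff, hl']
  exact h1

theorem IsInvolutiveDistribution.eventually_finrank {d : ℕ}
    {D : (Fin n → ℝ) → Submodule ℝ (Fin n → ℝ)} (h : IsInvolutiveDistribution d D) :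
    ∀ᶠ x in 𝓝 (0 : Fin n → ℝ), Module.finrank ℝ (D x) = d := by
  obtain ⟨v, -, hv⟩ := h.frame
  filter_upwards [hv] with x hx
  rw [hx.2, finrank_span_eq_card hx.1, Fintype.card_fin]

/-- Descending induction on `l`. On the dense open set the spanning brackets lie in the coordinate
flag by `lieBracket_eventuallyEq_zero`. By continuity the first `l` components of a smooth frame of
`D l` vanish near the origin, including where the bracket span degenerates, and equality of
dimensions finishes. -/
theorem IsSystemFlag.eventually_eq_coordFlag {f g : (Fin n → ℝ) → (Fin n → ℝ)}
    (hfg : IsLowerTriangularForm f g) {D : ℕ → (Fin n → ℝ) → Submodule ℝ (Fin n → ℝ)}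
    (hD : IsSystemFlag f g D) (l : ℕ) (hl : l ≤ n) :
    ∀ᶠ x in 𝓝 (0 : Fin n → ℝ), D l x = coordFlag n l := by
  induction hd : n - l using Nat.strong_induction_on generalizing l with
  | _ d ih =>
    rcases eq_or_lt_of_le hl with rfl | hl'
    · filter_upwards [hD.bot] with x hx
      rw [hx, coordFlag_self]
    rcases eq_or_lt_of_le (Nat.succ_le_of_lt hl') with h | h
    · filter_upwards [hD.top l h, hfg.eventually_span_g h] with x h1 h2
      rw [h1, h2]
    obtain ⟨Γ, hΓ, hstep⟩ := hD.step
    obtain ⟨O, -, hOcl, hO⟩ := hstep l h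
    have hbr : ∀ᶠ x in 𝓝 (0 : Fin n → ℝ), ∀ (j m : Fin n), l < j.val → m.val < l →
        VectorField.lieBracket ℝ (Γ j) f x m = 0 := by
      refine eventually_all.2 fun j => eventually_all.2 fun m => ?_
      by_cases hjm : l < j.val ∧ m.val < l
      · have hΓj : ∀ᶠ x in 𝓝 (0 : Fin n → ℝ), Γ j x ∈ coordFlag n j.val := by
          filter_upwards [(hΓ j (by omega)).2.1, ih (n - j.val) (by omega) j.val j.isLt.le rfl]
            with x h1 h2
          rwa [← h2]
        filter_upwards [lieBracket_eventuallyEq_zero hfg.smooth_f hfg.dep (hΓ j (by omega)).1 hΓj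
          (m := m) (by omega)] with x hx _ _ using hx
      · exact Eventually.of_forall fun x h1 h2 => absurd ⟨h1, h2⟩ hjm
    have hle : ∀ᶠ x in 𝓝 (0 : Fin n → ℝ), x ∈ O → D l x ≤ coordFlag n l := by
      filter_upwards [hbr, hfg.eventually_g_mem] with x h1 h2 hx
      rw [hO x hx, Submodule.span_le]
      rintro w (rfl | ⟨j, hj, rfl⟩)
      · exact coordFlag_anti (by omega) h2
      · exact fun m hm => h1 j m hj hm
    obtain ⟨v, hv, hfr⟩ := (hD.involutive l hl).frame
    have hzero : ∀ᶠ x in 𝓝 (0 : Fin n → ℝ), ∀ (s : Fin (n - l)) (m : Fin n), m.val < l →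
        v s x m = 0 := by
      refine eventually_all.2 fun s => eventually_all.2 fun m => ?_
      by_cases hm : m.val < l
      · have := eventuallyEq_zero_of_dense (smoothNear_pi.1 (hv s) m) hOcl (by
          filter_upwards [hle, hfr] with x h1 h2 hx
          have h3 : v s x ∈ D l x := by
            rw [h2.2]; exact Submodule.subset_span ⟨s, rfl⟩
          exact h1 hx h3 m hm)
        filter_upwards [this] with x hx _ using hx
      · exact Eventually.of_forall fun x h => absurd h hm
    filter_upwards [hzero, hfr, (hD.involutive l hl).eventually_finrank] with x h1 h2 h3
    refine Submodule.eq_of_le_of_finrank_eq ?_ (by rw [h3, finrank_coordFlag])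
    rw [h2.2, Submodule.span_le]
    rintro _ ⟨s, rfl⟩
    exact fun m hm => h1 s m hm

/-- Descending induction on `l`. For `k ≤ m < l`, the `m`-th component of `[X l, Y k] ∈ D l`
vanishes. There `X l` has zero `m`-th component and no components before `l`, and derivatives in
directions beyond `l` are zero by induction. What is left is `(X l)_l * ∂_l (Y k)_m = 0` with a
nonzero first factor. -/
theorem IsReducedTuple.isTriangularTuple {D : ℕ → (Fin n → ℝ) → Submodule ℝ (Fin n → ℝ)}
    {X Y : Fin n → (Fin n → ℝ) → (Fin n → ℝ)}
    (hD : ∀ l ≤ n, ∀ᶠ x in 𝓝 (0 : Fin n → ℝ), D l x = coordFlag n l)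
    (hX : IsAdapted D X) (hY : IsReducedTuple D X Y) : IsTriangularTuple Y := by
  have hlow : ∀ k m, m < k → (fun x => Y k x m) =ᶠ[𝓝 0] fun _ => 0 := by
    intro k m hm
    filter_upwards [hY.span_eq k, hD k.val k.isLt.le] with x h1 h2
    have h3 : Y k x ∈ coordFlag n k.val := by
      rw [← h2, h1]
      exact Submodule.subset_span ⟨k, le_rfl, rfl⟩
    exact h3 m hm
  refine ⟨hY.smooth, hlow, fun k m l hml => ?_, fun k h0 => ?_⟩
  · rcases lt_or_ge m k with hmk | hkm
    · exact partialD_congr_zero l (hlow k m hmk)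
    have hind : ∀ d, ∀ l : Fin n, n - l.val = d → m < l →
        partialD l (fun x => Y k x m) =ᶠ[𝓝 0] fun _ => 0 := by
      intro d
      induction d using Nat.strong_induction_on with
      | _ d ih =>
        intro l hd hml
        have hXl : ∀ᶠ x in 𝓝 (0 : Fin n → ℝ), X l x ∈ coordFlag n l.val := by
          filter_upwards [(hX l).2.1, hD l.val l.isLt.le] with x h1 h2
          rwa [← h2]
        have hne : X l 0 l ≠ 0 := by
          intro h0
          apply (hX l).2.2
          rw [(hD (l.val + 1) l.isLt).self_of_nhds]
          intro r hr
          rcases Nat.lt_succ_iff_lt_or_eq.1 hr with h1 | h1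
          · exact hXl.self_of_nhds r h1
          · rw [Fin.ext h1, h0]
        have hbr : ∀ᶠ x in 𝓝 (0 : Fin n → ℝ), VectorField.lieBracket ℝ (X l) (Y k) x m = 0 := by
          filter_upwards [hY.bracket k l (lt_of_le_of_lt hkm hml), hD l.val l.isLt.le] with x h1 h2
          rw [h2] at h1
          exact h1 m hml
        have hX0 : ∀ᶠ x in 𝓝 (0 : Fin n → ℝ), ∀ r, partialD r (fun y => X l y m) x = 0 := by
          refine eventually_all.2 fun r => partialD_congr_zero r ?_
          filter_upwards [hXl] with x hx using hx m hml
        have hr : ∀ᶠ x in 𝓝 (0 : Fin n → ℝ), ∀ r, r ≠ l →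
            X l x r * partialD r (fun y => Y k y m) x = 0 := by
          refine eventually_all.2 fun r => ?_
          rcases lt_trichotomy r l with h1 | h1 | h1
          · filter_upwards [hXl] with x hx _
            rw [hx r h1, zero_mul]
          · exact Eventually.of_forall fun x h => absurd h1 h
          · rw [Fin.lt_def] at h1
            filter_upwards [ih (n - r.val) (by omega) r rfl (hml.trans h1)] with x hx _
            rw [hx, mul_zero]
        filter_upwards [lieBracket_apply (hX l).1 (hY.smooth k) m, hbr, hX0, hr,
          (smoothNear_pi.1 (hX l).1 l).continuousAt.eventually_ne hne] with x h1 h2 h3 h4 h5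
        rw [h2, Finset.sum_eq_single l (fun r _ hr => h4 r hr) (by simp)] at h1
        simp only [h3, mul_zero, Finset.sum_const_zero, sub_zero] at h1
        exact (mul_eq_zero.1 h1.symm).resolve_left h5
    exact hind _ l rfl hml
  -- If `Y k 0` had zero `k`-th entry, so would all `Y j 0` with `j ≥ k`, yet these span a space
  -- containing `e_k`.
  · have h1 : (Pi.single k 1 : Fin n → ℝ) ∈
        Submodule.span ℝ {w | ∃ j : Fin n, k ≤ j ∧ w = Y j 0} := by
      rw [← (hY.span_eq k).self_of_nhds, (hD k.val k.isLt.le).self_of_nhds]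
      exact single_mem_coordFlag le_rfl
    have h2 : Submodule.span ℝ {w | ∃ j : Fin n, k ≤ j ∧ w = Y j 0}
        ≤ LinearMap.ker (LinearMap.proj (R := ℝ) (φ := fun _ : Fin n => ℝ) k) := by
      rw [Submodule.span_le]
      rintro _ ⟨j, hj, rfl⟩
      rcases eq_or_lt_of_le hj with rfl | h
      · exact h0
      · exact (hlow j k h).self_of_nhds
    have h3 := h2 h1
    simp at h3

/-! ### The standard admissible triple of a lower triangular form -/

theorem isInvolutiveDistribution_coordFlag (l : ℕ) :
    IsInvolutiveDistribution (n - l) (fun _ => coordFlag n l) := by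
  refine ⟨⟨fun i _ => stdFrame n l i, fun i => smoothNear_const _, Eventually.of_forall fun x =>
    ⟨linearIndependent_stdFrame l, coordFlag_eq_span l⟩⟩, fun V W hV hW hVs hWs => ?_⟩
  refine eventually_all.2 fun m => ?_
  by_cases hm : m.val < l
  · have hz : ∀ {Z : (Fin n → ℝ) → (Fin n → ℝ)}, IsSection Z (fun _ => coordFlag n l) →
        ∀ᶠ x in 𝓝 (0 : Fin n → ℝ), ∀ r, partialD r (fun y => Z y m) x = 0 := fun hZ =>
      eventually_all.2 fun r => partialD_congr_zero r (by
        filter_upwards [hZ] with x hx using hx m hm)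
    filter_upwards [lieBracket_apply hV hW m, hz hVs, hz hWs] with x h1 h2 h3 _
    rw [h1]
    simp [h2, h3]
  · exact Eventually.of_forall fun x h => absurd h hm

/-- Choosing `Γ j = ∂_j` gives `[Γ j, f] = ∂f/∂x_j`, whose first possibly nonzero component is the
one before the `j`-th. Where these components are all nonzero, the brackets and `g` are in echelon
form; this happens on a set that is open and dense near the origin. -/
theorem isSystemFlag_coordFlag {f g : (Fin n → ℝ) → (Fin n → ℝ)}
    (hfg : IsLowerTriangularForm f g) : IsSystemFlag f g (fun l _ => coordFlag n l) := by
  refine ⟨fun l _ => isInvolutiveDistribution_coordFlag l,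
    Eventually.of_forall fun x => coordFlag_self, fun l hl => hfg.eventually_span_g hl,
    fun j _ => Pi.single j 1, fun j _ => ⟨smoothNear_const _,
      Eventually.of_forall fun x => single_mem_coordFlag le_rfl,
      fun h => single_notMem_coordFlag j h.self_of_nhds⟩, fun i hi => ?_⟩
  have hbr : ∀ᶠ x in 𝓝 (0 : Fin n → ℝ), ∀ j m : Fin n, m.val + 1 < j.val →
      VectorField.lieBracket ℝ (fun _ => Pi.single j 1) f x m = 0 := by
    refine eventually_all.2 fun j => eventually_all.2 fun m => ?_
    by_cases hjm : m.val + 1 < j.val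
    · filter_upwards [lieBracket_eventuallyEq_zero hfg.smooth_f hfg.dep
        (smoothNear_const (Pi.single j 1)) (j := j.val)
        (Eventually.of_forall fun x => single_mem_coordFlag le_rfl) hjm] with x hx _ using hx
    · exact Eventually.of_forall fun x h => absurd h hjm
  have hpd : ∀ᶠ x in 𝓝 (0 : Fin n → ℝ), ∀ j m : Fin n,
      VectorField.lieBracket ℝ (fun _ => Pi.single j 1) f x m
        = partialD j (fun y => f y m) x := by
    refine eventually_all.2 fun j => eventually_all.2 fun m => ?_
    filter_upwards [lieBracket_apply (smoothNear_const (Pi.single j 1)) hfg.smooth_f m] with x hx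
    rw [hx, Finset.sum_eq_single j]
    · simp [partialD_const]
    · intro r _ hr; simp [hr]
    · simp
  -- The condition is vacuous for `j = 0`. Interiors are used below because smoothness, hence
  -- openness of nonvanishing, is only known near the origin.
  set A : Fin n → Set (Fin n → ℝ) := fun j =>
    {x | ∀ a : Fin n, a.val + 1 = j.val → partialD j (fun y => f y a) x ≠ 0} with hA
  have hAcl : ∀ j, closure (interior (A j)) ∈ 𝓝 0 := by
    intro j
    by_cases hj : ∃ a : Fin n, a.val + 1 = j.val
    · obtain ⟨a, ha⟩ := hj
      refine closure_mem_nhds_of_eventually (hfg.nonvanishing a j ha) ?_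
      filter_upwards [(smoothNear_pi.1 hfg.smooth_f a).partialD j] with x hx hne
      rw [mem_interior_iff_mem_nhds]
      filter_upwards [hx.continuousAt.eventually_ne hne] with y hy b hb
      obtain rfl : b = a := Fin.ext (by omega)
      exact hy
    · have : A j = Set.univ := Set.eq_univ_of_forall fun x a ha => absurd ⟨a, ha⟩ hj
      simp [this]
  obtain ⟨N, hN, hNo, hN0⟩ := eventually_nhds_iff.1
    (hbr.and (hpd.and (hfg.eventually_g_mem.and hfg.eventually_g_ne)))
  have hB := closure_iInter_mem_nhds Finset.univ (A := fun j => interior (A j))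
    (fun j => isOpen_interior) hAcl
  refine ⟨N ∩ {x | ∀ j ∈ Finset.univ, x ∈ interior (A j)}, hNo.inter ?_,
    closure_inter_mem_nhds hNo (mem_of_superset (hNo.mem_nhds hN0) subset_closure) hB, ?_⟩
  · have : {x | ∀ j ∈ Finset.univ, x ∈ interior (A j)} = ⋂ j, interior (A j) := by ext; simp
    rw [this]
    exact isOpen_iInter_of_finite fun j => isOpen_interior
  · rintro x ⟨hxN, hxA⟩
    obtain ⟨h1, h2, h3, h4⟩ := hN x hxN
    refine le_antisymm (coordFlag_le_of_mem fun k hk => ?_) (Submodule.span_le.2 ?_)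
    · by_cases hkn : k.val + 1 = n
      · exact ⟨g x, Submodule.subset_span (.inl rfl), coordFlag_anti (by omega) h3, h4 k hkn⟩
      · have hk' : k.val + 1 < n := by omega
        refine ⟨_, Submodule.subset_span (.inr ⟨⟨k.val + 1, hk'⟩, ?_, rfl⟩), fun m hm => ?_, ?_⟩
        · simp only; omega
        · exact h1 ⟨k.val + 1, hk'⟩ m (by simpa using hm)
        · rw [h2]
          exact interior_subset (hxA ⟨k.val + 1, hk'⟩ (Finset.mem_univ _)) k rfl
    · rintro w (rfl | ⟨j, hj, rfl⟩)
      · exact coordFlag_anti (by omega) h3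
      · exact fun m hm => h1 j m (by omega)

theorem isAdapted_coordFlag :
    IsAdapted (fun l _ => coordFlag n l) (fun k _ => Pi.single k 1) := fun l =>
  ⟨smoothNear_const _, Eventually.of_forall fun _ => single_mem_coordFlag le_rfl,
    single_notMem_coordFlag l⟩

theorem isReducedTuple_coordFlag :
    IsReducedTuple (fun l _ => coordFlag n l) (fun k _ => Pi.single k 1)
      (fun k _ => Pi.single k 1) := by
  refine ⟨fun k => smoothNear_const _, fun k => Eventually.of_forall fun x => ?_,
    fun k l _ => Eventually.of_forall fun x => ?_⟩
  · refine le_antisymm (coordFlag_le_of_mem fun j hj => ⟨_, Submodule.subset_span ⟨j, hj, rfl⟩,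
      single_mem_coordFlag le_rfl, by simp⟩) (Submodule.span_le.2 ?_)
    rintro _ ⟨j, hj, rfl⟩
    exact single_mem_coordFlag hj
  · have : VectorField.lieBracket ℝ (fun _ : Fin n → ℝ => (Pi.single l 1 : Fin n → ℝ))
        (fun _ => Pi.single k 1) x = 0 := by simp [VectorField.lieBracket]
    rw [this]
    exact Submodule.zero_mem _

/-! ### Transport along a change of coordinates -/

/-- `S` and `T` are mutually inverse germs of diffeomorphisms fixing the origin. -/
structure IsInversePair (S T : (Fin n → ℝ) → (Fin n → ℝ)) : Prop where
  smooth : SmoothNear S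
  smooth' : SmoothNear T
  zero : S 0 = 0
  zero' : T 0 = 0
  left : ∀ᶠ x in 𝓝 (0 : Fin n → ℝ), T (S x) = x
  right : ∀ᶠ x in 𝓝 (0 : Fin n → ℝ), S (T x) = x

open VectorField

namespace IsInversePair

variable {S T : (Fin n → ℝ) → (Fin n → ℝ)} (h : IsInversePair S T)

include h

theorem symm : IsInversePair T S := ⟨h.smooth', h.smooth, h.zero', h.zero, h.right, h.left⟩

theorem tendsto : Tendsto S (𝓝 0) (𝓝 0) := tendsto_of_smoothNear h.smooth h.zero

theorem fderiv_left : ∀ᶠ x in 𝓝 (0 : Fin n → ℝ), ∀ v,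
    fderiv ℝ T (S x) (fderiv ℝ S x v) = v := by
  filter_upwards [h.left.eventually_nhds, h.tendsto.eventually h.smooth'.differentiable,
    h.smooth.differentiable] with x h1 h2 h3 v
  have h4 : fderiv ℝ (fun y => T (S y)) x = (fderiv ℝ T (S x)).comp (fderiv ℝ S x) :=
    fderiv_comp x h2 h3
  have h5 : fderiv ℝ (fun y => T (S y)) x = fderiv ℝ (fun y => y) x :=
    Filter.EventuallyEq.fderiv_eq h1
  have h6 := congrArg (fun L : (Fin n → ℝ) →L[ℝ] (Fin n → ℝ) => L v) (h4.symm.trans h5)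
  simpa using h6

theorem fderiv_right : ∀ᶠ x in 𝓝 (0 : Fin n → ℝ), ∀ v,
    fderiv ℝ S x (fderiv ℝ T (S x) v) = v := by
  filter_upwards [h.tendsto.eventually h.symm.fderiv_left, h.left] with x h1 h2 v
  have := h1 v
  rwa [h2] at this

theorem pullback_eq (V : (Fin n → ℝ) → (Fin n → ℝ)) :
    pullback ℝ S V =ᶠ[𝓝 0] fun x => fderiv ℝ T (S x) (V (S x)) := by
  filter_upwards [h.fderiv_left, h.fderiv_right] with x h1 h2
  exact pullback_eq_of_fderiv_eq (M := ContinuousLinearEquiv.equivOfInverse (fderiv ℝ S x)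
    (fderiv ℝ T (S x)) h1 h2) rfl V

theorem fderiv_pullback : ∀ᶠ x in 𝓝 (0 : Fin n → ℝ), ∀ V : (Fin n → ℝ) → (Fin n → ℝ),
    fderiv ℝ S x (pullback ℝ S V x) = V (S x) := by
  filter_upwards [h.fderiv_left, h.fderiv_right] with x h1 h2 V
  exact VectorField.fderiv_pullback S V x ⟨ContinuousLinearEquiv.equivOfInverse (fderiv ℝ S x)
    (fderiv ℝ T (S x)) h1 h2, rfl⟩

theorem smoothNear_pullback {V : (Fin n → ℝ) → (Fin n → ℝ)} (hV : SmoothNear V) :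
    SmoothNear (pullback ℝ S V) := by
  refine SmoothNear.congr ?_ (h.pullback_eq V).symm
  have h1 : SmoothNear (fun x => fderiv ℝ T (S x)) := h.smooth'.fderiv.comp h.smooth h.zero
  filter_upwards [h1, hV.comp h.smooth h.zero] with x h2 h3 using h2.clm_apply h3

theorem pullback_pullback (V : (Fin n → ℝ) → (Fin n → ℝ)) :
    pullback ℝ T (pullback ℝ S V) =ᶠ[𝓝 0] V := by
  filter_upwards [h.symm.pullback_eq (pullback ℝ S V), h.right,
    h.symm.tendsto.eventually h.fderiv_pullback] with x h1 h2 h3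
  rw [h1, h3, h2]

theorem pullback_lieBracket {V W : (Fin n → ℝ) → (Fin n → ℝ)} (hV : SmoothNear V)
    (hW : SmoothNear W) : pullback ℝ S (lieBracket ℝ V W) =ᶠ[𝓝 0]
      lieBracket ℝ (pullback ℝ S V) (pullback ℝ S W) := by
  filter_upwards [h.smooth, h.tendsto.eventually hV.differentiable,
    h.tendsto.eventually hW.differentiable] with x h1 h2 h3
  exact VectorField.pullback_lieBracket
    (by simpa using (show ((2 : ℕ∞) : WithTop ℕ∞) ≤ ∞ from mod_cast le_top)) h1 h2 h3

theorem pullback_adMulti {Y : Fin n → (Fin n → ℝ) → (Fin n → ℝ)} (hY : ∀ k, SmoothNear (Y k))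
    (α : Fin n → ℕ) {F : (Fin n → ℝ) → (Fin n → ℝ)} (hF : SmoothNear F) :
    adMulti (fun k => pullback ℝ S (Y k)) α (pullback ℝ S F)
      =ᶠ[𝓝 0] pullback ℝ S (adMulti Y α F) := by
  have hit : ∀ (k : Fin n) (m : ℕ) {W V : (Fin n → ℝ) → (Fin n → ℝ)}, SmoothNear W →
      V =ᶠ[𝓝 0] pullback ℝ S W → SmoothNear ((lieBracket ℝ (Y k))^[m] W) ∧
        (lieBracket ℝ (pullback ℝ S (Y k)))^[m] V
          =ᶠ[𝓝 0] pullback ℝ S ((lieBracket ℝ (Y k))^[m] W) := by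
    intro k m W V hW hV
    induction m with
    | zero => exact ⟨hW, hV⟩
    | succ m ih =>
      simp only [Function.iterate_succ_apply']
      exact ⟨(hY k).lieBracket ih.1, (EventuallyEq.rfl.lieBracket_vectorField ih.2).trans
        (h.pullback_lieBracket (hY k) ih.1).symm⟩
  have hl : ∀ l : List (Fin n),
      SmoothNear (l.foldr (fun k W => (lieBracket ℝ (Y k))^[α k] W) F) ∧
        l.foldr (fun k W => (lieBracket ℝ (pullback ℝ S (Y k)))^[α k] W) (pullback ℝ S F)
          =ᶠ[𝓝 0] pullback ℝ S (l.foldr (fun k W => (lieBracket ℝ (Y k))^[α k] W) F) := by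
    intro l
    induction l with
    | nil => exact ⟨hF, EventuallyEq.rfl⟩
    | cons a l ih => exact hit a (α a) ih.1 ih.2
  exact (hl _).2

end IsInversePair

/-- The pullback of a family of distributions. -/
def comapFlag (S : (Fin n → ℝ) → (Fin n → ℝ))
    (D : ℕ → (Fin n → ℝ) → Submodule ℝ (Fin n → ℝ)) (l : ℕ) (x : Fin n → ℝ) :
    Submodule ℝ (Fin n → ℝ) :=
  (D l (S x)).comap (fderiv ℝ S x).toLinearMap

namespace IsInversePair

variable {S T : (Fin n → ℝ) → (Fin n → ℝ)} (h : IsInversePair S T)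
  {D : ℕ → (Fin n → ℝ) → Submodule ℝ (Fin n → ℝ)}

include h

theorem comap_span : ∀ᶠ x in 𝓝 (0 : Fin n → ℝ), ∀ s : Set (Fin n → ℝ),
    (Submodule.span ℝ s).comap (fderiv ℝ S x).toLinearMap
      = Submodule.span ℝ (fderiv ℝ T (S x) '' s) := by
  filter_upwards [h.fderiv_left, h.fderiv_right] with x h1 h2 s
  have e : Submodule.span ℝ (fderiv ℝ T (S x) '' s)
      = (Submodule.span ℝ s).map (fderiv ℝ T (S x)).toLinearMap :=
    (Submodule.map_span (fderiv ℝ T (S x)).toLinearMap s).symm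
  rw [e]
  ext w
  simp only [Submodule.mem_comap, Submodule.mem_map, ContinuousLinearMap.coe_coe]
  constructor
  · exact fun hw => ⟨_, hw, h1 w⟩
  · rintro ⟨v, hv, rfl⟩
    rwa [h2]

theorem mem_comapFlag : ∀ᶠ x in 𝓝 (0 : Fin n → ℝ), ∀ (V : (Fin n → ℝ) → (Fin n → ℝ)) (l : ℕ),
    pullback ℝ S V x ∈ comapFlag S D l x ↔ V (S x) ∈ D l (S x) := by
  filter_upwards [h.fderiv_pullback] with x hx V l
  rw [comapFlag, Submodule.mem_comap, ContinuousLinearMap.coe_coe, hx]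

theorem isSection_pullback_iff {V : (Fin n → ℝ) → (Fin n → ℝ)} {l : ℕ} :
    IsSection (pullback ℝ S V) (comapFlag S D l) ↔ IsSection V (D l) := by
  constructor
  · intro hV
    filter_upwards [h.symm.tendsto.eventually hV,
      h.symm.tendsto.eventually (h.mem_comapFlag (D := D)), h.right] with x h1 h2 h3
    rw [h2, h3] at h1
    exact h1
  · intro hV
    filter_upwards [h.tendsto.eventually hV, h.mem_comapFlag (D := D)] with x h1 h2
    exact (h2 V l).2 h1

theorem isSection_comapFlag_iff {V : (Fin n → ℝ) → (Fin n → ℝ)} {l : ℕ} :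
    IsSection (pullback ℝ T V) (D l) ↔ IsSection V (comapFlag S D l) := by
  rw [← h.isSection_pullback_iff]
  have e := h.symm.pullback_pullback V
  constructor
  · intro hs
    filter_upwards [hs, e] with x h1 h2
    rwa [← h2]
  · intro hs
    filter_upwards [hs, e] with x h1 h2
    rwa [h2]

theorem isInvolutiveDistribution_comapFlag {l d : ℕ} (hD : IsInvolutiveDistribution d (D l)) :
    IsInvolutiveDistribution d (comapFlag S D l) := by
  obtain ⟨v, hv, hfr⟩ := hD.frame
  refine ⟨⟨fun i => pullback ℝ S (v i), fun i => h.smoothNear_pullback (hv i), ?_⟩,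
    fun V W hV hW hVs hWs => ?_⟩
  · have hp : ∀ᶠ x in 𝓝 (0 : Fin n → ℝ), ∀ i,
        pullback ℝ S (v i) x = fderiv ℝ T (S x) (v i (S x)) :=
      eventually_all.2 fun i => h.pullback_eq (v i)
    filter_upwards [hp, h.tendsto.eventually hfr, h.comap_span, h.fderiv_right]
      with x h1 h2 h3 h4
    have e : (fun i => pullback ℝ S (v i) x)
        = (fderiv ℝ T (S x)).toLinearMap ∘ fun i => v i (S x) := funext h1
    rw [e]
    constructor
    · refine h2.1.map' _ (LinearMap.ker_eq_bot_of_injective ?_)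
      exact Function.LeftInverse.injective (g := fderiv ℝ S x) h4
    · rw [comapFlag, h2.2, h3, Set.range_comp]
      rfl
  · have h1 := hD.involutive _ _ (h.symm.smoothNear_pullback hV) (h.symm.smoothNear_pullback hW)
      (h.isSection_comapFlag_iff.2 hVs) (h.isSection_comapFlag_iff.2 hWs)
    rw [← h.isSection_comapFlag_iff]
    filter_upwards [h1, h.symm.pullback_lieBracket hV hW] with x h2 h3
    rwa [h3]

/-- `S` is a local homeomorphism at the origin, so density near it is preserved. -/
theorem closure_preimage_mem_nhds {O : Set (Fin n → ℝ)} (hO : closure O ∈ 𝓝 0) :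
    closure (S ⁻¹' O) ∈ 𝓝 0 := by
  have hT : ∀ᶠ x in 𝓝 (0 : Fin n → ℝ), ContinuousAt T (S x) :=
    h.tendsto.eventually (h.smooth'.differentiable.mono fun x hx => hx.continuousAt)
  filter_upwards [h.tendsto hO, h.left, hT, h.tendsto.eventually h.right.eventually_nhds]
    with x h1 h2 h3 h4
  have h5 : Tendsto T (𝓝 (S x)) (𝓝 x) := by
    have := h3.tendsto
    rwa [h2] at this
  rw [mem_closure_iff_frequently]
  refine h5.frequently ?_
  have h6 : ∃ᶠ y in 𝓝 (S x), y ∈ O := mem_closure_iff_frequently.1 h1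
  refine (h6.and_eventually h4).mono fun y hy => ?_
  rw [Set.mem_preimage, hy.2]
  exact hy.1

theorem isSystemFlag_comapFlag {F G : (Fin n → ℝ) → (Fin n → ℝ)} (hF : SmoothNear F)
    (hD : IsSystemFlag F G D) :
    IsSystemFlag (pullback ℝ S F) (pullback ℝ S G) (comapFlag S D) := by
  refine ⟨fun l hl => h.isInvolutiveDistribution_comapFlag (hD.involutive l hl), ?_, ?_, ?_⟩
  · filter_upwards [h.tendsto.eventually hD.bot, h.fderiv_left] with x h1 h2
    rw [comapFlag, h1, Submodule.comap_bot]
    exact LinearMap.ker_eq_bot_of_injective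
      (Function.LeftInverse.injective (g := fderiv ℝ T (S x)) h2)
  · intro l hl
    filter_upwards [h.tendsto.eventually (hD.top l hl), h.comap_span, h.pullback_eq G]
      with x h1 h2 h3
    rw [comapFlag, h1, h2, Set.image_singleton, h3]
  · obtain ⟨Γ, hΓ, hstep⟩ := hD.step
    refine ⟨fun j => pullback ℝ S (Γ j), fun j hj => ⟨h.smoothNear_pullback (hΓ j hj).1,
      h.isSection_pullback_iff.2 (hΓ j hj).2.1, fun hc =>
        (hΓ j hj).2.2 (h.isSection_pullback_iff.1 hc)⟩, fun i hi => ?_⟩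
    obtain ⟨O, hOo, hOcl, hO⟩ := hstep i hi
    have hbr : ∀ᶠ x in 𝓝 (0 : Fin n → ℝ), ∀ j : Fin n, i < j.val →
        lieBracket ℝ (pullback ℝ S (Γ j)) (pullback ℝ S F) x
          = fderiv ℝ T (S x) (lieBracket ℝ (Γ j) F (S x)) := by
      refine eventually_all.2 fun j => ?_
      by_cases hj : i < j.val
      · filter_upwards [h.pullback_lieBracket (hΓ j (by omega)).1 hF,
          h.pullback_eq (lieBracket ℝ (Γ j) F)] with x h1 h2 _
        rw [← h1, h2]
      · exact Eventually.of_forall fun x h => absurd h hj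
    have hgood := hbr.and ((h.pullback_eq G).and (h.comap_span.and h.smooth.differentiable))
    -- A system flag needs the span identity at every point of an open set, while the transport
    -- formulas hold only near the origin; they are therefore built into the set.
    refine ⟨interior {x | S x ∈ O ∧ (∀ j : Fin n, i < j.val →
        lieBracket ℝ (pullback ℝ S (Γ j)) (pullback ℝ S F) x
          = fderiv ℝ T (S x) (lieBracket ℝ (Γ j) F (S x))) ∧
        pullback ℝ S G x = fderiv ℝ T (S x) (G (S x)) ∧
        ∀ s : Set (Fin n → ℝ), (Submodule.span ℝ s).comap (fderiv ℝ S x).toLinearMap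
          = Submodule.span ℝ (fderiv ℝ T (S x) '' s)}, isOpen_interior, ?_, ?_⟩
    · refine closure_mem_nhds_of_eventually (h.closure_preimage_mem_nhds hOcl) ?_
      filter_upwards [hgood.eventually_nhds] with x hx hxO
      rw [mem_interior_iff_mem_nhds]
      have hc : ContinuousAt S x := hx.self_of_nhds.2.2.2.continuousAt
      filter_upwards [hx, hc.preimage_mem_nhds (hOo.mem_nhds hxO)] with y h1 h2
      exact ⟨h2, h1.1, h1.2.1, h1.2.2.1⟩
    · intro x hx
      obtain ⟨h1, h2, h3, h4⟩ := interior_subset hx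
      rw [comapFlag, hO _ h1, h4, Set.image_union, Set.image_singleton, h3]
      congr 2
      ext w
      constructor
      · rintro ⟨_, ⟨j, hj, rfl⟩, rfl⟩
        exact ⟨j, hj, (h2 j hj).symm⟩
      · rintro ⟨j, hj, rfl⟩
        exact ⟨_, ⟨j, hj, rfl⟩, (h2 j hj).symm⟩

theorem isAdapted_comapFlag {X : Fin n → (Fin n → ℝ) → (Fin n → ℝ)} (hX : IsAdapted D X) :
    IsAdapted (comapFlag S D) (fun l => pullback ℝ S (X l)) := fun l => by
  refine ⟨h.smoothNear_pullback (hX l).1, h.isSection_pullback_iff.2 (hX l).2.1, fun hc => ?_⟩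
  rw [(h.mem_comapFlag (D := D)).self_of_nhds, h.zero] at hc
  exact (hX l).2.2 hc

theorem isReducedTuple_comapFlag {X Y : Fin n → (Fin n → ℝ) → (Fin n → ℝ)}
    (hX : ∀ l, SmoothNear (X l)) (hY : IsReducedTuple D X Y) :
    IsReducedTuple (comapFlag S D) (fun l => pullback ℝ S (X l))
      (fun l => pullback ℝ S (Y l)) := by
  refine ⟨fun k => h.smoothNear_pullback (hY.smooth k), fun k => ?_, fun k l hkl => ?_⟩
  · have hp : ∀ᶠ x in 𝓝 (0 : Fin n → ℝ), ∀ i,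
        pullback ℝ S (Y i) x = fderiv ℝ T (S x) (Y i (S x)) :=
      eventually_all.2 fun i => h.pullback_eq (Y i)
    filter_upwards [h.tendsto.eventually (hY.span_eq k), h.comap_span, hp] with x h1 h2 h3
    rw [comapFlag, h1, h2]
    congr 1
    ext w
    constructor
    · rintro ⟨_, ⟨j, hj, rfl⟩, rfl⟩
      exact ⟨j, hj, (h3 j).symm⟩
    · rintro ⟨j, hj, rfl⟩
      exact ⟨_, ⟨j, hj, rfl⟩, (h3 j).symm⟩
  · filter_upwards [h.isSection_pullback_iff.2 (hY.bracket k l hkl),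
      h.pullback_lieBracket (hX l) (hY.smooth k)] with x h1 h2
    rwa [← h2]

theorem bracketCondition_comapFlag_iff {F : (Fin n → ℝ) → (Fin n → ℝ)} (hF : SmoothNear F)
    {Y : Fin n → (Fin n → ℝ) → (Fin n → ℝ)} (hY : ∀ k, SmoothNear (Y k))
    (E : Fin n → Set (Fin n → ℕ)) :
    BracketCondition (pullback ℝ S F) (comapFlag S D) (fun k => pullback ℝ S (Y k)) E
      ↔ BracketCondition F D Y E := by
  have key : ∀ (α : Fin n → ℕ) (l : ℕ),
      adMulti (fun k => pullback ℝ S (Y k)) α (pullback ℝ S F) 0 ∈ comapFlag S D l 0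
        ↔ adMulti Y α F 0 ∈ D l 0 := by
    intro α l
    rw [(h.pullback_adMulti hY α hF).self_of_nhds, (h.mem_comapFlag (D := D)).self_of_nhds,
      h.zero]
  simp only [BracketCondition, key]

end IsInversePair

/-! ### Feedback equivalence -/

theorem IsSystemFlag.congr {F F' G G' : (Fin n → ℝ) → (Fin n → ℝ)}
    {D : ℕ → (Fin n → ℝ) → Submodule ℝ (Fin n → ℝ)} (hD : IsSystemFlag F G D)
    (hF : F =ᶠ[𝓝 0] F') (hG : G =ᶠ[𝓝 0] G') : IsSystemFlag F' G' D := by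
  obtain ⟨Γ, hΓ, hstep⟩ := hD.step
  refine ⟨hD.involutive, hD.bot, fun l hl => ?_, Γ, hΓ, fun i hi => ?_⟩
  · filter_upwards [hD.top l hl, hG] with x h1 h2
    rw [h1, h2]
  · obtain ⟨O, hOo, hOcl, hO⟩ := hstep i hi
    have hbr : ∀ᶠ x in 𝓝 (0 : Fin n → ℝ), ∀ j : Fin n,
        lieBracket ℝ (Γ j) F x = lieBracket ℝ (Γ j) F' x :=
      eventually_all.2 fun j => EventuallyEq.rfl.lieBracket_vectorField hF
    obtain ⟨N, hN, hNo, hN0⟩ := eventually_nhds_iff.1 (hbr.and hG)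
    refine ⟨N ∩ O, hNo.inter hOo, closure_inter_mem_nhds hNo
      (mem_of_superset (hNo.mem_nhds hN0) subset_closure) hOcl, ?_⟩
    rintro x ⟨hxN, hxO⟩
    rw [hO x hxO, (hN x hxN).2]
    simp only [(hN x hxN).1]

theorem DependsOnFirst.congr {k : ℕ} {p q : (Fin n → ℝ) → ℝ} (hp : DependsOnFirst k p)
    (hpq : p =ᶠ[𝓝 0] q) : DependsOnFirst k q := by
  obtain ⟨U, hU, hUp⟩ := hp
  refine ⟨U ∩ {x | p x = q x}, inter_mem hU hpq, ?_⟩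
  rintro x ⟨hx, hx'⟩ y ⟨hy, hy'⟩ hxy
  rw [← show p x = q x from hx', ← show p y = q y from hy']
  exact hUp x hx y hy hxy

theorem essentialSet_congr {p q : (Fin n → ℝ) → ℝ} (j : Fin n) (hpq : p =ᶠ[𝓝 0] q) :
    essentialSet j p = essentialSet j q := by
  have : indices p = indices q := by
    ext α
    exact not_congr (by rw [multiD_congr_zero α hpq])
  simp only [essentialSet, this]

/-- A system that is feedback equivalent to a lower triangular form is itself a lower triangular
form in suitable coordinates, because the last component of such a form is arbitrary. -/
theorem FeedbackEquivalent.exists_coordinates {F G f g : (Fin n → ℝ) → (Fin n → ℝ)}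
    (hF : SmoothNear F) (hG : SmoothNear G) (hfg : IsLowerTriangularForm f g)
    (hfe : FeedbackEquivalent F G f g) :
    ∃ S T : (Fin n → ℝ) → (Fin n → ℝ), IsInversePair S T ∧
      IsLowerTriangularForm (pullback ℝ S F) (pullback ℝ S G) ∧
        ∀ E, HasType f E → HasType (pullback ℝ S F) E := by
  obtain ⟨a, b, T, -, hb, hb0, ⟨hT, hT0, S, hS, hS0, hST, hTS⟩, heq⟩ := hfe
  have h : IsInversePair S T := ⟨hS, hT, hS0, hT0, hTS, hST⟩
  have hbS : ContinuousAt (fun x => b (S x)) 0 := (hb.comp hS hS0).continuousAt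
  have key : ∀ᶠ x in 𝓝 (0 : Fin n → ℝ), b (S x) ≠ 0 ∧
      b (S x) • pullback ℝ S G x = g x ∧
      pullback ℝ S F x = f x - a (S x) • pullback ℝ S G x := by
    filter_upwards [h.pullback_eq F, h.pullback_eq G, h.tendsto.eventually heq, h.left,
      hbS.eventually_ne (by simpa [hS0] using hb0)] with x h1 h2 h3 h4 h5
    -- The values `v = 0` and `v = 1` separate the drift from the control field.
    have e0 := h3 0
    have e1 := h3 1
    rw [h4, map_add, map_smul, ← h1, ← h2] at e0 e1
    simp only [mul_zero, add_zero, zero_smul, mul_one, one_smul, add_smul] at e0 e1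
    refine ⟨h5, ?_, eq_sub_of_add_eq e0⟩
    rw [← e0, ← add_assoc] at e1
    exact add_left_cancel e1
  have hg0 : ∀ i : Fin n, i.val + 1 < n → (fun x => pullback ℝ S G x i) =ᶠ[𝓝 0] fun _ => 0 := by
    intro i hi
    filter_upwards [key, hfg.g_zero i hi] with x h1 h2
    have h3 := congrFun h1.2.1 i
    rw [h2, Pi.smul_apply, smul_eq_mul] at h3
    exact (mul_eq_zero.1 h3).resolve_left h1.1
  -- The feedback adds a multiple of the control field, which has only a last component; all other
  -- components of the drift are unchanged, and the type sees only these.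
  have hf : ∀ i : Fin n, i.val + 1 < n →
      (fun x => f x i) =ᶠ[𝓝 0] fun x => pullback ℝ S F x i := by
    intro i hi
    filter_upwards [key, hg0 i hi] with x h1 h2
    rw [h1.2.2, Pi.sub_apply, Pi.smul_apply, h2]
    simp
  refine ⟨S, T, h, ⟨h.smoothNear_pullback hF, h.smoothNear_pullback hG, fun i => ?_,
    fun i j hij => ?_, hg0, fun i hi hc => ?_⟩, fun E hE i j hij => ?_⟩
  · by_cases hi : i.val + 1 < n
    · exact (hfg.dep i).congr (hf i hi)
    -- For the last component the allowed variables are all of them.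
    · refine ⟨Set.univ, univ_mem, fun x _ y _ hxy => ?_⟩
      rw [show x = y from funext fun j => hxy j (by omega)]
  · refine closure_mem_nhds_of_eventually (hfg.nonvanishing i j hij) ?_
    filter_upwards [partialD_congr j (hf i (by omega))] with x h1 h2
    rwa [← h1]
  · have h1 := congrFun key.self_of_nhds.2.1 i
    rw [Pi.smul_apply, hc, smul_zero] at h1
    exact hfg.g_ne i hi h1.symm
  · rw [← hE i j hij]
    exact (essentialSet_congr j (hf i (by omega))).symm

theorem IsInversePair.feedbackEquivalent {S T : (Fin n → ℝ) → (Fin n → ℝ)}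
    (h : IsInversePair S T) (F G : (Fin n → ℝ) → (Fin n → ℝ)) :
    FeedbackEquivalent F G (pullback ℝ S F) (pullback ℝ S G) := by
  refine ⟨fun _ => 0, fun _ => 1, T, smoothNear_const 0, smoothNear_const 1, one_ne_zero,
    ⟨h.smooth', h.zero', S, h.smooth, h.zero, h.right, h.left⟩, ?_⟩
  filter_upwards [h.symm.tendsto.eventually (h.pullback_eq F),
    h.symm.tendsto.eventually (h.pullback_eq G), h.right] with ξ h1 h2 h3 v
  rw [h1, h2, h3, zero_add, one_mul, map_add, map_smul]

/-- The left side does not involve `(D, X, Y)`, so the bracket condition has the same truth value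
for all admissible triples. -/
theorem IsInversePair.hasType_iff {S T : (Fin n → ℝ) → (Fin n → ℝ)} (h : IsInversePair S T)
    {F G : (Fin n → ℝ) → (Fin n → ℝ)} (hF : SmoothNear F)
    (hfg : IsLowerTriangularForm (pullback ℝ S F) (pullback ℝ S G))
    {D : ℕ → (Fin n → ℝ) → Submodule ℝ (Fin n → ℝ)} {X Y : Fin n → (Fin n → ℝ) → (Fin n → ℝ)}
    (hD : IsSystemFlag F G D) (hX : IsAdapted D X) (hY : IsReducedTuple D X Y)
    {E : Fin n → Set (Fin n → ℕ)} (hE : IsTypeData E) :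
    HasType (pullback ℝ S F) E ↔ BracketCondition F D Y E := by
  have hflag := (h.isSystemFlag_comapFlag hF hD).eventually_eq_coordFlag hfg
  rw [← h.bracketCondition_comapFlag_iff hF hY.smooth]
  exact hasType_iff_bracketCondition hfg.smooth_f hfg.dep
    ((h.isReducedTuple_comapFlag (fun l => (hX l).1) hY).isTriangularTuple hflag
      (h.isAdapted_comapFlag hX)) (fun l hl => (hflag l hl.le).self_of_nhds) hE

/-- The standard triple of the form is carried back along `T`; this recovers `F` and `G` only as
germs. -/
theorem IsInversePair.exists_admissible {S T : (Fin n → ℝ) → (Fin n → ℝ)}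
    (h : IsInversePair S T) {F G : (Fin n → ℝ) → (Fin n → ℝ)}
    (hfg : IsLowerTriangularForm (pullback ℝ S F) (pullback ℝ S G)) :
    ∃ (D : ℕ → (Fin n → ℝ) → Submodule ℝ (Fin n → ℝ)) (X Y : Fin n → (Fin n → ℝ) → (Fin n → ℝ)),
      IsSystemFlag F G D ∧ IsAdapted D X ∧ IsReducedTuple D X Y :=
  ⟨_, _, _, (h.symm.isSystemFlag_comapFlag hfg.smooth_f (isSystemFlag_coordFlag hfg)).congr
    (h.pullback_pullback F) (h.pullback_pullback G), h.symm.isAdapted_comapFlag isAdapted_coordFlag,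
    h.symm.isReducedTuple_comapFlag (fun _ => smoothNear_const _) isReducedTuple_coordFlag⟩

end TriForm

end

/-! ### The two equivalences -/

theorem mainTheorem10 (n : ℕ) (F G : (Fin n → ℝ) → (Fin n → ℝ))
    (hF : SmoothNear F) (hF0 : F 0 = 0) (hG : SmoothNear G) (hG0 : ∃ j : Fin n, G 0 j ≠ 0)
    (E : Fin n → Set (Fin n → ℕ)) (hE : IsTypeData E) :
    (EquivToType F G E ↔
      EquivToLowerTriangular F G ∧
        ∀ (D : ℕ → (Fin n → ℝ) → Submodule ℝ (Fin n → ℝ))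
          (X Y : Fin n → (Fin n → ℝ) → (Fin n → ℝ)),
          IsSystemFlag F G D → IsAdapted D X → IsReducedTuple D X Y →
            BracketCondition F D Y E) ∧
    (EquivToType F G E ↔
      EquivToLowerTriangular F G ∧
        ∃ (D : ℕ → (Fin n → ℝ) → Submodule ℝ (Fin n → ℝ))
          (X Y : Fin n → (Fin n → ℝ) → (Fin n → ℝ)),
          IsSystemFlag F G D ∧ IsAdapted D X ∧ IsReducedTuple D X Y ∧
            BracketCondition F D Y E) := by
  have hall : EquivToType F G E → EquivToLowerTriangular F G ∧
      ∀ (D : ℕ → (Fin n → ℝ) → Submodule ℝ (Fin n → ℝ))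
        (X Y : Fin n → (Fin n → ℝ) → (Fin n → ℝ)),
        IsSystemFlag F G D → IsAdapted D X → IsReducedTuple D X Y →
          BracketCondition F D Y E := by
    rintro ⟨f, g, hfg, hfE, hfe⟩
    refine ⟨⟨f, g, hfg, hfe⟩, fun D X Y hD hX hY => ?_⟩
    obtain ⟨S, T, h, hfg', hE'⟩ := hfe.exists_coordinates hF hG hfg
    exact (h.hasType_iff hF hfg' hD hX hY hE).1 (hE' E hfE)
  -- Without an admissible triple the condition over all triples would be vacuous.
  have hadm : EquivToLowerTriangular F G →
      ∃ (D : ℕ → (Fin n → ℝ) → Submodule ℝ (Fin n → ℝ))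
        (X Y : Fin n → (Fin n → ℝ) → (Fin n → ℝ)),
        IsSystemFlag F G D ∧ IsAdapted D X ∧ IsReducedTuple D X Y := by
    rintro ⟨f, g, hfg, hfe⟩
    obtain ⟨S, T, h, hfg', -⟩ := hfe.exists_coordinates hF hG hfg
    exact h.exists_admissible hfg'
  have hsome : EquivToLowerTriangular F G →
      ∀ (D : ℕ → (Fin n → ℝ) → Submodule ℝ (Fin n → ℝ))
        (X Y : Fin n → (Fin n → ℝ) → (Fin n → ℝ)),
        IsSystemFlag F G D → IsAdapted D X → IsReducedTuple D X Y →
          BracketCondition F D Y E → EquivToType F G E := by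
    rintro ⟨f, g, hfg, hfe⟩ D X Y hD hX hY hB
    obtain ⟨S, T, h, hfg', -⟩ := hfe.exists_coordinates hF hG hfg
    exact ⟨_, _, hfg', (h.hasType_iff hF hfg' hD hX hY hE).2 hB, h.feedbackEquivalent F G⟩
  refine ⟨⟨hall, fun h => ?_⟩, ⟨fun h => ?_, fun h => ?_⟩⟩
  · obtain ⟨D, X, Y, hD, hX, hY⟩ := hadm h.1
    exact hsome h.1 D X Y hD hX hY (h.2 D X Y hD hX hY)
  · obtain ⟨h1, h2⟩ := hall h
    obtain ⟨D, X, Y, hD, hX, hY⟩ := hadm h1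
    exact ⟨h1, D, X, Y, hD, hX, hY, h2 D X Y hD hX hY⟩
  · obtain ⟨h1, D, X, Y, hD, hX, hY, hB⟩ := h
    exact hsome h1 D X Y hD hX hY hB
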